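/- Theorem 3.1. Let $K$ be a field, let $V$ be a finite-dimensional $K$-vector space, and let $E=\bigwedge V$ be the exterior algebra, with maximal ideal $\mathfrak m=\bigoplus_{i\ge 1}\bigwedge^i V$. A complex $\mathbf G$ of free left $E$-modules is called minimal if every differential $d\colon G\to G'$ satisfies $d(G)\subseteq \mathfrak m G'$. Given bases of the terms of a minimal free complex $\mathbf G$, let $\operatorname{lin}(\mathbf G)$ be the complex with the same terms in which each matrix representing a differential is replaced by its linear part, i.e. the matrix obtained by erasing, in all entries, the components lying in $\bigwedge^i V$ with $i>1$. A linear part of a complex $\mathbf F$ of $E$-modules is a complex isomorphic to $\operatorname{lin}(\mathbf G)$ (for some choice of bases), where $\mathbf G$ is a minimal free complex homotopy equivalent to $\mathbf F$. Let $M$ be a finitely generated left $E$-module and let $\mathbf F$ be a free resolution or an injective resolution of $M$ (not necessarily minimal). Then $\mathbf F$ has a linear part, and every linear part of $\mathbf F$ is eventually exact: there is an $N$, which may depend on all the data, such that it is exact at the $n$-th term (in homological degree $n$ for a free resolution, in cohomological degree $n$ for an injective resolution) for all $n\ge N$. -/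

import Mathlib

open CategoryTheory

universe u v

section LinearPart

variable {K : Type u} [Field K] {V : Type v} [AddCommGroup V] [Module K V]

/-- The maximal ideal of the exterior algebra `E = ⋀ V`: the elements whose component in
`⋀⁰ V = K` vanishes. -/
noncomputable def maxIdeal (K : Type u) [Field K] (V : Type v) [AddCommGroup V] [Module K V] :
    Ideal (ExteriorAlgebra K V) :=
  (HomogeneousIdeal.irrelevant (fun i : ℕ ↦ ⋀[K]^i V)).toIdeal

/-- The linear part of an element of the exterior algebra: all components in `⋀ⁱ V` with `i > 1`
are erased. -/
noncomputable def linElem : ExteriorAlgebra K V →ₗ[K] ExteriorAlgebra K V :=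
  GradedAlgebra.proj (fun i : ℕ ↦ ⋀[K]^i V) 0 + GradedAlgebra.proj (fun i : ℕ ↦ ⋀[K]^i V) 1

/-- The linear part of a map of free modules with respect to given bases: the map whose matrix is
obtained by taking the linear part of each entry of the matrix of `f`. -/
noncomputable def linMap {M N ι κ : Type*} [AddCommGroup M] [Module (ExteriorAlgebra K V) M]
    [AddCommGroup N] [Module (ExteriorAlgebra K V) N]
    (b : Module.Basis ι (ExteriorAlgebra K V) M) (c : Module.Basis κ (ExteriorAlgebra K V) N)
    (f : M →ₗ[ExteriorAlgebra K V] N) : M →ₗ[ExteriorAlgebra K V] N :=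
  b.constr ℕ fun i ↦ c.repr.symm ((c.repr (f (b i))).mapRange linElem (map_zero linElem))

/-- A map is minimal if its image lies in the maximal ideal times the target; for free modules,
this says that the entries of its matrix lie in the maximal ideal. -/
def IsMinimalMap {M N : Type*} [AddCommGroup M] [Module (ExteriorAlgebra K V) M]
    [AddCommGroup N] [Module (ExteriorAlgebra K V) N] (f : M →ₗ[ExteriorAlgebra K V] N) : Prop :=
  LinearMap.range f ≤ maxIdeal K V • (⊤ : Submodule (ExteriorAlgebra K V) N)

theorem linElem_mul_linElem {a e : ExteriorAlgebra K V} (ha : a ∈ maxIdeal K V)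
    (he : e ∈ maxIdeal K V) :
    linElem a * linElem e = GradedAlgebra.proj (fun i : ℕ ↦ ⋀[K]^i V) 2 (a * e) := by
  have ha' : GradedAlgebra.proj (fun i : ℕ ↦ ⋀[K]^i V) 0 a = 0 :=
    (HomogeneousIdeal.mem_irrelevant_iff _ a).1 ha
  have he' : GradedAlgebra.proj (fun i : ℕ ↦ ⋀[K]^i V) 0 e = 0 :=
    (HomogeneousIdeal.mem_irrelevant_iff _ e).1 he
  simp only [linElem, LinearMap.add_apply, ha', he', zero_add]
  simp only [GradedAlgebra.proj_apply] at ha' he' ⊢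
  rw [DirectSum.decompose_mul, DirectSum.coe_mul_apply_eq_sum_antidiagonal,
    show Finset.HasAntidiagonal.antidiagonal 2 = {(0, 2), (1, 1), (2, 0)} from rfl]
  simp [ha', he']

theorem repr_mem_maxIdeal {N κ : Type*} [AddCommGroup N] [Module (ExteriorAlgebra K V) N]
    (c : Module.Basis κ (ExteriorAlgebra K V) N) {x : N}
    (hx : x ∈ maxIdeal K V • (⊤ : Submodule (ExteriorAlgebra K V) N)) (k : κ) :
    c.repr x k ∈ maxIdeal K V := by
  refine Submodule.smul_induction_on hx (fun a ha y _ ↦ ?_) (fun x y hx hy ↦ ?_)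
  · rw [map_smul, Finsupp.smul_apply, smul_eq_mul]
    have ha' : GradedRing.proj (fun i : ℕ ↦ ⋀[K]^i V) 0 a = 0 :=
      (HomogeneousIdeal.mem_irrelevant_iff _ a).1 ha
    refine (HomogeneousIdeal.mem_irrelevant_iff _ _).2 ?_
    rw [GradedRing.proj_apply] at ha' ⊢
    rw [DirectSum.decompose_mul, DirectSum.coe_mul_apply_eq_sum_antidiagonal]
    simp [ha']
  · rw [map_add, Finsupp.add_apply]
    exact add_mem hx hy

theorem linMap_zero {M N ι κ : Type*} [AddCommGroup M] [Module (ExteriorAlgebra K V) M]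
    [AddCommGroup N] [Module (ExteriorAlgebra K V) N]
    (b : Module.Basis ι (ExteriorAlgebra K V) M) (c : Module.Basis κ (ExteriorAlgebra K V) N) :
    linMap b c 0 = 0 := by
  refine b.ext fun i ↦ ?_
  simp [linMap, Module.Basis.constr_basis]

theorem linMap_comp_linMap {M N P ι κ μ : Type*}
    [AddCommGroup M] [Module (ExteriorAlgebra K V) M]
    [AddCommGroup N] [Module (ExteriorAlgebra K V) N]
    [AddCommGroup P] [Module (ExteriorAlgebra K V) P]
    (b : Module.Basis ι (ExteriorAlgebra K V) M) (c : Module.Basis κ (ExteriorAlgebra K V) N)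
    (d : Module.Basis μ (ExteriorAlgebra K V) P)
    {f : M →ₗ[ExteriorAlgebra K V] N} {g : N →ₗ[ExteriorAlgebra K V] P}
    (hf : IsMinimalMap f) (hg : IsMinimalMap g) (h : g ∘ₗ f = 0) :
    linMap c d g ∘ₗ linMap b c f = 0 := by
  classical
  refine b.ext fun i ↦ ?_
  have hfi : ∀ j, c.repr (f (b i)) j ∈ maxIdeal K V :=
    repr_mem_maxIdeal c (hf ⟨b i, rfl⟩)
  have hgj : ∀ j k, d.repr (g (c j)) k ∈ maxIdeal K V := fun j k ↦
    repr_mem_maxIdeal d (hg ⟨c j, rfl⟩) k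
  have hlin : ∀ x : N, (∀ j, c.repr x j ∈ maxIdeal K V) → ∀ k,
      d.repr (linMap c d g (c.repr.symm ((c.repr x).mapRange linElem (map_zero linElem)))) k =
        GradedAlgebra.proj (fun i : ℕ ↦ ⋀[K]^i V) 2 (d.repr (g x) k) := by
    intro x hx k
    have e1 : g x = (c.repr x).sum fun j a ↦ a • g (c j) := by
      conv_lhs => rw [← c.linearCombination_repr x]
      rw [Finsupp.linearCombination_apply, map_finsuppSum]
      simp
    rw [e1, linMap, Module.Basis.constr_apply, LinearEquiv.apply_symm_apply,
      Finsupp.sum_mapRange_index (by simp)]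
    simp only [Finsupp.sum, map_sum, map_smul, LinearEquiv.apply_symm_apply,
      Finsupp.coe_finsetSum, Finset.sum_apply, Finsupp.smul_apply, smul_eq_mul,
      Finsupp.mapRange_apply]
    exact Finset.sum_congr rfl fun j _ ↦ linElem_mul_linElem (hx j) (hgj j k)
  apply d.repr.injective
  ext k
  have h0 : g (f (b i)) = 0 := LinearMap.congr_fun h (b i)
  have := hlin (f (b i)) hfi k
  rw [h0] at this
  rw [LinearMap.comp_apply, show linMap b c f (b i) = _ from b.constr_basis ℕ _ i, this]
  simp

/-- A complex of free modules over the exterior algebra is minimal if all its differentials are. -/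
structure IsMinimalFree {I : Type*} {s : ComplexShape I}
    (G : HomologicalComplex (ModuleCat.{max u v} (ExteriorAlgebra K V)) s) : Prop where
  free : ∀ i, Module.Free (ExteriorAlgebra K V) (G.X i)
  minimal : ∀ i j, IsMinimalMap (G.d i j).hom

/-- The linear part of a minimal free complex `G`, with respect to bases of its terms: the complex
with the same terms in which each differential is replaced by its linear part. -/
noncomputable def linComplex {I : Type*} {s : ComplexShape I}
    (G : HomologicalComplex (ModuleCat.{max u v} (ExteriorAlgebra K V)) s) (hG : IsMinimalFree G)
    {ι : I → Type (max u v)} (b : ∀ i, Module.Basis (ι i) (ExteriorAlgebra K V) (G.X i)) :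
    HomologicalComplex (ModuleCat.{max u v} (ExteriorAlgebra K V)) s where
  X := G.X
  d i j := ModuleCat.ofHom (linMap (b i) (b j) (G.d i j).hom)
  shape i j hij := by
    rw [G.shape i j hij, ModuleCat.hom_zero, linMap_zero, ModuleCat.ofHom_zero]
  d_comp_d' i j k _ _ := by
    rw [← ModuleCat.ofHom_comp, linMap_comp_linMap _ _ _ (hG.minimal i j) (hG.minimal j k),
      ModuleCat.ofHom_zero]
    rw [← ModuleCat.hom_comp, G.d_comp_d, ModuleCat.hom_zero]

/-- `L` is (up to isomorphism) the linear part of the complex `F`: there are a minimal free complex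
`G` homotopy equivalent to `F` and bases of the terms of `G` such that `L` is isomorphic to the
linear part of `G` with respect to these bases. -/
def IsLinearPart {I : Type*} {s : ComplexShape I}
    (F L : HomologicalComplex (ModuleCat.{max u v} (ExteriorAlgebra K V)) s) : Prop :=
  ∃ (G : HomologicalComplex (ModuleCat.{max u v} (ExteriorAlgebra K V)) s) (hG : IsMinimalFree G)
    (ι : I → Type (max u v)) (b : ∀ i, Module.Basis (ι i) (ExteriorAlgebra K V) (G.X i)),
    Nonempty (HomotopyEquiv F G) ∧ Nonempty (L ≅ linComplex G hG b)

end LinearPart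

-- Consider a minimal cochain complex of free modules, exact in positive degrees, with
-- finite-dimensional cycles `M` in degree zero. Let `N` be the sum of its terms, `d` its
-- differential and `S` the polynomial ring with one variable `x_v` for each vector `e_v` of a basis
-- of `V`. On `S ⊗ N` put `D = d + ∑ x_v L_v`, where `L_v` is left multiplication by `e_v` with a
-- sign.
--
-- Filter `S ⊗ N` in two ways. By polynomial degree, the part `∑ x_v L_v` is exact except in degree
-- zero, and minimality makes `d` vanish on the socle of `N`; hence the socle embeds into `(S ⊗ N) /
-- im D` (`eq_zero_of_totalD_eq_one_tmul`). By cohomological degree, every `D`-cycle is homologous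
-- to one in `S ⊗ M` (`exists_sub_totalD_mem`). So the socle classes form a noetherian `S`-module
-- `Q`, a model of `Ext_E(K, M)`. It has one `K`-basis vector for each free generator of `N`, and
-- `x_v` acts on it, up to sign, by the `e_v`-coefficients of the matrix of `d`
-- (`exists_noetherian_model`).
--
-- Up to signs, the linear part is therefore `Q ⊗ E` with differential `∑ x_v ⊗ (right
-- multiplication by e_v)`. Its homology is noetherian over `S` and, by contraction, killed by every
-- `x_v`. Hence it is finite-dimensional (`exists_finset_cycles`) and vanishes in large degrees
-- (`exists_linStd_exact`, `exists_linMap_exact`).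
--
-- Free resolutions reduce to this by duality. As `E` is Frobenius, transposing matrices of finite
-- rank and reversing their entries preserves and reflects exactness (`exact_reverseTranspose_iff`),
-- and it commutes with linear parts (`linMap_reverseTranspose`). A minimal complex homotopy
-- equivalent to a resolution is exact in positive degrees, and it has terms of finite rank or
-- finitely generated cycles in degree zero, as the two cases require. Linear parts exist because
-- minimal generating sets, and dually embeddings that extend an embedding of the socle, yield
-- minimal resolutions by free modules.

universe w w'

/-! ### Exactness of the Cartan differential on a polynomial ring tensored with a vector space. -/

section Cartan

open TensorProduct MvPolynomial

variable {K σ : Type*} [Field K]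

/-- Division of polynomials by the variable `X v`, discarding the remainder. -/
noncomputable def divX (v : σ) : MvPolynomial σ K →ₗ[K] MvPolynomial σ K where
  toFun p := p.divMonomial (Finsupp.single v 1)
  map_add' p q := add_divMonomial p q _
  map_smul' a p := by
    ext s
    simp [coeff_divMonomial]

theorem coeff_divX (v : σ) (p : MvPolynomial σ K) (s : σ →₀ ℕ) :
    coeff s (divX v p) = coeff (Finsupp.single v 1 + s) p :=
  coeff_divMonomial _ _ _

theorem divX_X_mul_self (v : σ) (p : MvPolynomial σ K) : divX v (X v * p) = p :=
  X_mul_divMonomial v p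

theorem divX_X_mul_of_ne {v w : σ} (h : v ≠ w) (p : MvPolynomial σ K) :
    divX v (X w * p) = X w * divX v p := by
  classical
  ext s
  rw [coeff_divX, coeff_X_mul', coeff_X_mul', coeff_divX]
  have h1 : w ∈ (Finsupp.single v 1 + s).support ↔ w ∈ s.support := by
    simp [h]
  simp only [h1]
  split_ifs with h2
  · congr 1
    ext a
    simp only [Finsupp.coe_tsub, Finsupp.coe_add, Pi.sub_apply, Pi.add_apply,
      Finsupp.single_apply]
    split_ifs with h3 h4 h4
    · exact absurd (h3.trans h4.symm) h
    all_goals omega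
  · rfl

/-- The part of a polynomial not involving the variable `X v`. -/
noncomputable def remX (v : σ) : MvPolynomial σ K →ₗ[K] MvPolynomial σ K :=
  LinearMap.id - LinearMap.mulLeft K (X v) ∘ₗ divX v

theorem X_mul_divX (v : σ) (p : MvPolynomial σ K) : X v * divX v p = p - remX v p := by
  simp [remX]

theorem coeff_remX [DecidableEq σ] (v : σ) (p : MvPolynomial σ K) (s : σ →₀ ℕ) :
    coeff s (remX v p) = if s v = 0 then coeff s p else 0 := by
  simp only [remX, LinearMap.sub_apply, LinearMap.id_apply, LinearMap.comp_apply,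
    LinearMap.mulLeft_apply, coeff_sub, coeff_X_mul', coeff_divX, Finsupp.mem_support_iff]
  by_cases h : s v = 0
  · simp [h]
  · have : Finsupp.single v 1 + (s - Finsupp.single v 1) = s := by
      refine add_tsub_cancel_of_le ?_
      simpa [Finsupp.single_le_iff] using Nat.one_le_iff_ne_zero.2 h
    simp [h, this]

/-- The part of a polynomial not involving any of the variables in a list. -/
noncomputable def remXList (l : List σ) : Module.End K (MvPolynomial σ K) :=
  (l.map remX).prod

theorem coeff_remXList [DecidableEq σ] (l : List σ) (p : MvPolynomial σ K) (s : σ →₀ ℕ) :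
    coeff s (remXList l p) = if ∀ v ∈ l, s v = 0 then coeff s p else 0 := by
  induction l generalizing p with
  | nil => simp [remXList]
  | cons v l ih =>
    have : remXList (v :: l) p = remX v (remXList l p) := by
      simp [remXList, Module.End.mul_apply]
    rw [this, coeff_remX, ih]
    by_cases h : s v = 0 <;> simp [h]

theorem remXList_univ [Fintype σ] (p : MvPolynomial σ K) :
    remXList Finset.univ.toList p = C (constantCoeff p) := by
  classical
  ext s
  rw [coeff_remXList, coeff_C, constantCoeff_eq]
  by_cases h : s = 0
  · simp [h]
  · have h' : ¬ ∀ v, s v = 0 := fun h' ↦ h (Finsupp.ext h')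
    simp [h', Ne.symm h]

theorem homogeneousComponent_succ_X_mul (n : ℕ) (v : σ) (p : MvPolynomial σ K) :
    homogeneousComponent (n + 1) (X v * p) = X v * homogeneousComponent n p := by
  classical
  ext s
  rw [coeff_homogeneousComponent, coeff_X_mul', coeff_X_mul', coeff_homogeneousComponent]
  by_cases h : v ∈ s.support
  · have : Finsupp.single v 1 + (s - Finsupp.single v 1) = s := by
      refine add_tsub_cancel_of_le ?_
      simpa [Finsupp.single_le_iff] using Nat.one_le_iff_ne_zero.2 (Finsupp.mem_support_iff.1 h)
    have h2 : s.degree = 1 + (s - Finsupp.single v 1).degree := by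
      conv_lhs => rw [← this]
      rw [map_add, Finsupp.degree_single]
    have h3 : s.degree = n + 1 ↔ (s - Finsupp.single v 1).degree = n := by omega
    simp only [h, if_true, h3]
  · simp [h]

variable [Fintype σ] {N : Type*} [AddCommGroup N] [Module K N]

/-- The Cartan differential `∑ᵥ xᵥ ⊗ Lᵥ`. -/
noncomputable def cartan (L : σ → Module.End K N) :
    (MvPolynomial σ K ⊗[K] N) →ₗ[MvPolynomial σ K] (MvPolynomial σ K ⊗[K] N) :=
  ∑ v, (X v : MvPolynomial σ K) • (L v).baseChange (MvPolynomial σ K)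

theorem cartan_tmul (L : σ → Module.End K N) (s : MvPolynomial σ K) (x : N) :
    cartan L (s ⊗ₜ x) = ∑ v, (X v * s) ⊗ₜ L v x := by
  simp [cartan, LinearMap.sum_apply, TensorProduct.smul_tmul']

/-- The terms for `(v, w)` and `(w, v)` cancel, since variables commute and the operators
anticommute. The diagonal needs `hsq` separately because the characteristic may be two. -/
theorem cartan_cartan {L : σ → Module.End K N} (hL : ∀ v w x, L v (L w x) = - L w (L v x))
    (hsq : ∀ v x, L v (L v x) = 0) (p : MvPolynomial σ K ⊗[K] N) : cartan L (cartan L p) = 0 := by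
  induction p with
  | zero => simp
  | add p q hp hq => simp [hp, hq]
  | tmul s x =>
    simp only [cartan_tmul, map_sum]
    rw [← Finset.sum_product' (s := Finset.univ) (t := Finset.univ)
      (f := fun w v ↦ (X v * (X w * s)) ⊗ₜ[K] L v (L w x))]
    refine Finset.sum_involution (fun a _ ↦ (a.2, a.1)) ?_ ?_ ?_ ?_
    · rintro ⟨a, b⟩ -
      rw [hL a b, TensorProduct.tmul_neg, mul_left_comm (X b : MvPolynomial σ K)]
      simp
    · rintro ⟨a, b⟩ - h hab
      obtain rfl : b = a := (Prod.ext_iff.1 hab).1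
      simp [hsq] at h
    · simp
    · simp

variable [DecidableEq σ]

/-- Only the summand of `v` survives: for `w ≠ v`, division by `X v` commutes with multiplication by
`X w`, while `c v` anticommutes with `L w`. -/
theorem cartan_homotopy {L c : σ → Module.End K N}
    (hc : ∀ v w x, c v (L w x) + L w (c v x) = if v = w then x else 0) (v : σ)
    (p : MvPolynomial σ K ⊗[K] N) :
    cartan L (TensorProduct.map (divX v) (c v) p) + TensorProduct.map (divX v) (c v) (cartan L p) =
      p - TensorProduct.map (remX v) (L v ∘ₗ c v) p := by
  induction p with
  | zero => simp
  | add p q hp hq =>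
    simp only [map_add]
    rw [add_sub_add_comm, ← hp, ← hq]
    abel
  | tmul s x =>
    simp only [cartan_tmul, map_sum, TensorProduct.map_tmul, ← Finset.sum_add_distrib]
    rw [Finset.sum_eq_single v]
    · rw [divX_X_mul_self, X_mul_divX, TensorProduct.sub_tmul, sub_add_eq_add_sub,
        ← TensorProduct.tmul_add, add_comm (L v _), hc]
      simp
    · intro w _ hw
      rw [divX_X_mul_of_ne hw.symm, ← TensorProduct.tmul_add, add_comm (L w _), hc]
      simp [hw.symm]
    · simp

/-- In presence of contractions, the Cartan differential is exact away from the constant part. -/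
theorem cartan_exact {L c : σ → Module.End K N}
    (hL : ∀ v w x, L v (L w x) = - L w (L v x)) (hsq : ∀ v x, L v (L v x) = 0)
    (hc : ∀ v w x, c v (L w x) + L w (c v x) = if v = w then x else 0)
    {p : MvPolynomial σ K ⊗[K] N} (hp : cartan L p = 0)
    (h0 : LinearMap.rTensor N (homogeneousComponent (σ := σ) (R := K) 0) p = 0) :
    ∃ q, cartan L q = p := by
  -- The variables are cleared one at a time: modulo boundaries, `p` is replaced by an image of its
  -- part free of the variables in `l`. Once all are cleared, only the constant part is left, and it
  -- vanishes by `h0`.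
  have key : ∀ l : List σ, ∃ (q : MvPolynomial σ K ⊗[K] N) (m : Module.End K N),
      p = cartan L q + TensorProduct.map (remXList l) m p := by
    intro l
    induction l with
    | nil => exact ⟨0, LinearMap.id, by simp [remXList, Module.End.one_eq_id]⟩
    | cons v l ih =>
      obtain ⟨q, m, hq⟩ := ih
      set p' := TensorProduct.map (remXList l) m p with hp'
      have h1 : cartan L p' = 0 := by
        have := congrArg (cartan L) hq
        rwa [hp, map_add, cartan_cartan hL hsq, zero_add, eq_comm] at this
      have h2 := cartan_homotopy hc v p'
      rw [h1, map_zero, add_zero] at h2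
      refine ⟨q + TensorProduct.map (divX v) (c v) p', (L v ∘ₗ c v) ∘ₗ m, ?_⟩
      have h3 : TensorProduct.map (remXList (v :: l)) ((L v ∘ₗ c v) ∘ₗ m) p =
          TensorProduct.map (remX v) (L v ∘ₗ c v) p' := by
        rw [hp', ← LinearMap.comp_apply (f := TensorProduct.map (remX v) _),
          ← TensorProduct.map_comp]
        rfl
      rw [h3, map_add, h2]
      rw [add_assoc, sub_add_cancel]
      exact hq
  obtain ⟨q, m, hq⟩ := key Finset.univ.toList
  refine ⟨q, ?_⟩
  have h1 : (remXList (K := K) (Finset.univ : Finset σ).toList) =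
      homogeneousComponent (σ := σ) (R := K) 0 := by
    refine LinearMap.ext fun p ↦ ?_
    rw [remXList_univ, homogeneousComponent_zero, constantCoeff_eq]
  have h2 : TensorProduct.map (remXList (Finset.univ : Finset σ).toList) m p = 0 := by
    rw [h1, ← LinearMap.lTensor_comp_rTensor, LinearMap.comp_apply, h0, map_zero]
  rw [h2, add_zero] at hq
  exact hq.symm

end Cartan

/-! ### The total differential and its two filtrations. -/

section TotalComplex

open TensorProduct MvPolynomial

variable {K σ : Type*} [Field K] {N : Type*} [AddCommGroup N] [Module K N]

/-- The projection of `S ⊗ N` to the component of polynomial degree `n`. -/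
noncomputable def polyComp (σ N : Type*) {K : Type*} [Field K] [AddCommGroup N] [Module K N]
    (n : ℕ) : Module.End K (MvPolynomial σ K ⊗[K] N) :=
  LinearMap.rTensor N (homogeneousComponent n)

theorem polyComp_tmul (n : ℕ) (s : MvPolynomial σ K) (x : N) :
    polyComp σ N n (s ⊗ₜ x) = homogeneousComponent n s ⊗ₜ x := rfl

theorem polyComp_baseChange (d : Module.End K N) (n : ℕ) (p : MvPolynomial σ K ⊗[K] N) :
    polyComp σ N n (d.baseChange (MvPolynomial σ K) p) =
      d.baseChange (MvPolynomial σ K) (polyComp σ N n p) := by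
  induction p with
  | zero => simp
  | add p q hp hq => simp [hp, hq]
  | tmul s x => simp [polyComp_tmul]

theorem polyComp_polyComp (m n : ℕ) (p : MvPolynomial σ K ⊗[K] N) :
    polyComp σ N m (polyComp σ N n p) = if m = n then polyComp σ N n p else 0 := by
  induction p with
  | zero => simp
  | add p q hp hq =>
    simp only [map_add, hp, hq]
    split_ifs <;> simp
  | tmul s x =>
    simp only [polyComp_tmul]
    rw [homogeneousComponent_of_mem (homogeneousComponent_mem n s)]
    split_ifs <;> simp_all

theorem sum_polyComp (p : MvPolynomial σ K ⊗[K] N) :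
    ∃ J, ∀ J' ≥ J, ∑ n ∈ Finset.range J', polyComp σ N n p = p := by
  induction p with
  | zero => exact ⟨0, by simp⟩
  | add p q hp hq =>
    obtain ⟨J, hJ⟩ := hp
    obtain ⟨J', hJ'⟩ := hq
    refine ⟨max J J', fun n hn ↦ ?_⟩
    simp only [map_add, Finset.sum_add_distrib]
    rw [hJ n (le_trans (le_max_left _ _) hn), hJ' n (le_trans (le_max_right _ _) hn)]
  | tmul s x =>
    refine ⟨s.totalDegree + 1, fun n hn ↦ ?_⟩
    simp only [polyComp_tmul]
    rw [← TensorProduct.sum_tmul]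
    congr 1
    conv_rhs => rw [← sum_homogeneousComponent s]
    refine (Finset.sum_subset (by simpa using hn) fun m _ hm ↦ ?_).symm
    exact homogeneousComponent_eq_zero _ _ (by simpa using hm)

theorem polyComp_eventually_zero (p : MvPolynomial σ K ⊗[K] N) :
    ∃ J, ∀ n ≥ J, polyComp σ N n p = 0 := by
  obtain ⟨J, hJ⟩ := sum_polyComp p
  refine ⟨J, fun n hn ↦ ?_⟩
  have := congrArg (polyComp σ N n) (hJ J le_rfl)
  rw [← this, map_sum]
  refine Finset.sum_eq_zero fun m hm ↦ ?_
  rw [polyComp_polyComp, if_neg]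
  have := Finset.mem_range.1 hm
  omega

theorem exists_polyComp_zero (p : MvPolynomial σ K ⊗[K] N) :
    ∃ x : N, polyComp σ N 0 p = 1 ⊗ₜ x := by
  induction p with
  | zero => exact ⟨0, by simp⟩
  | add p q hp hq =>
    obtain ⟨x, hx⟩ := hp
    obtain ⟨y, hy⟩ := hq
    exact ⟨x + y, by rw [map_add, hx, hy, TensorProduct.tmul_add]⟩
  | tmul s x =>
    refine ⟨coeff 0 s • x, ?_⟩
    rw [polyComp_tmul, homogeneousComponent_zero, ← TensorProduct.smul_tmul, smul_eq_C_mul, mul_one]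

theorem eq_one_tmul_of_polyComp {p : MvPolynomial σ K ⊗[K] N}
    (hp : ∀ n ≥ 1, polyComp σ N n p = 0) : ∃ x : N, p = 1 ⊗ₜ x := by
  obtain ⟨x, hx⟩ := exists_polyComp_zero p
  refine ⟨x, ?_⟩
  obtain ⟨J, hJ⟩ := sum_polyComp p
  have h := hJ (J + 1) (by omega)
  rwa [Finset.sum_range_succ', Finset.sum_eq_zero fun n _ ↦ hp (n + 1) (by omega), zero_add, hx,
    eq_comm] at h

/-- The coefficient map `S ⊗ N → N` at a monomial. -/
noncomputable def tensorCoeff (N : Type*) [AddCommGroup N] [Module K N] (a : σ →₀ ℕ) :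
    MvPolynomial σ K ⊗[K] N →ₗ[K] N :=
  (TensorProduct.lid K N).toLinearMap ∘ₗ LinearMap.rTensor N (lcoeff K a)

theorem tensorCoeff_tmul (a : σ →₀ ℕ) (s : MvPolynomial σ K) (x : N) :
    tensorCoeff N a (s ⊗ₜ x) = coeff a s • x := by
  simp [tensorCoeff]

variable [Fintype σ]

theorem polyComp_succ_cartan (L : σ → Module.End K N) (n : ℕ) (p : MvPolynomial σ K ⊗[K] N) :
    polyComp σ N (n + 1) (cartan L p) = cartan L (polyComp σ N n p) := by
  induction p with
  | zero => simp
  | add p q hp hq => simp [hp, hq]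
  | tmul s x => simp [polyComp_tmul, cartan_tmul, homogeneousComponent_succ_X_mul]

/-- The total differential on `S ⊗ N`. -/
noncomputable def totalD (L : σ → Module.End K N) (d : Module.End K N) :
    (MvPolynomial σ K ⊗[K] N) →ₗ[MvPolynomial σ K] (MvPolynomial σ K ⊗[K] N) :=
  d.baseChange (MvPolynomial σ K) + cartan L

theorem totalD_apply (L : σ → Module.End K N) (d : Module.End K N)
    (p : MvPolynomial σ K ⊗[K] N) :
    totalD L d p = d.baseChange (MvPolynomial σ K) p + cartan L p := rfl

theorem totalD_totalD {L : σ → Module.End K N} {d : Module.End K N}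
    (hL : ∀ v w x, L v (L w x) = - L w (L v x)) (hsq : ∀ v x, L v (L v x) = 0)
    (hd : ∀ x, d (d x) = 0) (hdL : ∀ v x, d (L v x) = - L v (d x))
    (p : MvPolynomial σ K ⊗[K] N) : totalD L d (totalD L d p) = 0 := by
  have h1 : d.baseChange (MvPolynomial σ K) (d.baseChange (MvPolynomial σ K) p) = 0 := by
    induction p with
    | zero => simp
    | add p q hp hq => simp [hp, hq]
    | tmul s x => simp [hd]
  have h2 : d.baseChange (MvPolynomial σ K) (cartan L p) =
      - cartan L (d.baseChange (MvPolynomial σ K) p) := by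
    clear h1
    induction p with
    | zero => simp
    | add p q hp hq =>
      simp only [map_add, hp, hq]
      abel
    | tmul s x => simp [cartan_tmul, hdL, TensorProduct.tmul_neg]
  simp only [totalD_apply, map_add, h1, h2, cartan_cartan hL hsq]
  abel

/-- If `d` vanishes on the common kernel of the `Lᵥ`, then no nonzero constant is a boundary. -/
theorem eq_zero_of_totalD_eq_one_tmul [DecidableEq σ] {L c : σ → Module.End K N}
    {d : Module.End K N}
    (hL : ∀ v w x, L v (L w x) = - L w (L v x)) (hsq : ∀ v x, L v (L v x) = 0)
    (hc : ∀ v w x, c v (L w x) + L w (c v x) = if v = w then x else 0)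
    (hd : ∀ x, d (d x) = 0) (hdL : ∀ v x, d (L v x) = - L v (d x))
    (hsoc : ∀ x, (∀ v, L v x = 0) → d x = 0)
    {p : MvPolynomial σ K ⊗[K] N} {y : N} (hp : totalD L d p = 1 ⊗ₜ y) : y = 0 := by
  obtain ⟨J, hJ⟩ := polyComp_eventually_zero p
  have hone : ∀ n, n ≠ 0 → polyComp σ N n ((1 : MvPolynomial σ K) ⊗ₜ[K] y) = 0 := by
    intro n hn
    rw [polyComp_tmul, homogeneousComponent_of_mem (isHomogeneous_one _ _), if_neg hn,
      TensorProduct.zero_tmul]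
  -- With the bound shifted by one, the base case of the induction is that of a constant `p`.
  replace hJ : ∀ n ≥ J + 1, polyComp σ N n p = 0 := fun n hn ↦ hJ n (by omega)
  induction J generalizing p with
  | zero =>
    obtain ⟨x, rfl⟩ := eq_one_tmul_of_polyComp hJ
    rw [totalD_apply, cartan_tmul, LinearMap.baseChange_tmul] at hp
    -- Compare coefficients at the variable `v`; the right-hand side of `hp` is constant.
    have hLx : ∀ v, L v x = 0 := by
      intro v
      have := congrArg (tensorCoeff N (Finsupp.single v 1)) hp
      have h1 : ∀ w : σ, (Finsupp.single w 1 = (Finsupp.single v 1 : σ →₀ ℕ)) ↔ w = v := by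
        intro w
        simp [Finsupp.single_left_inj]
      have h2 : (0 : σ →₀ ℕ) ≠ Finsupp.single v 1 := by simp [eq_comm]
      simpa [tensorCoeff_tmul, coeff_X, coeff_one, h1, h2, ite_smul] using this
    have h0 := congrArg (tensorCoeff N (0 : σ →₀ ℕ)) hp
    have h3 := hsoc x hLx
    simpa [hLx, h3, tensorCoeff_tmul] using h0.symm
  | succ J ih =>
    -- In polynomial degree `J + 2` only the Cartan image of the leading component of `p`
    -- contributes.
    have hz : cartan L (polyComp σ N (J + 1) p) = 0 := by
      have := congrArg (polyComp σ N (J + 2)) hp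
      rw [totalD_apply, map_add, polyComp_baseChange, hJ (J + 2) (by omega), map_zero, zero_add,
        polyComp_succ_cartan, hone _ (by omega)] at this
      exact this
    obtain ⟨q, hq⟩ := cartan_exact hL hsq hc hz (by
      have := polyComp_polyComp 0 (J + 1) p
      rwa [if_neg (by omega)] at this)
    have hq' : cartan L (polyComp σ N J q) = polyComp σ N (J + 1) p := by
      rw [← polyComp_succ_cartan, hq, polyComp_polyComp, if_pos rfl]
    -- Subtracting a boundary does not change the total differential of `p`, and this one cancels
    -- the leading component.
    refine ih (p := p - totalD L d (polyComp σ N J q)) ?_ ?_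
    · rw [map_sub, totalD_totalD hL hsq hd hdL, sub_zero, hp]
    · intro n hn
      rw [map_sub, totalD_apply, map_add, polyComp_baseChange, polyComp_polyComp,
        if_neg (by omega), hq', polyComp_polyComp, map_zero, zero_add]
      split_ifs with h
      · rw [h, sub_self]
      · rw [hJ n (by omega), sub_zero]

/-- Such a `k` picks primitives of boundaries linearly, so exactness of `d` can be carried to the
tensor product as an identity between operators. -/
theorem exists_pseudoinverse (d : Module.End K N) :
    ∃ k : Module.End K N, ∀ x, d (k (d x)) = d x := by
  obtain ⟨g, hg⟩ := d.rangeRestrict.exists_rightInverse_of_surjective d.range_rangeRestrict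
  obtain ⟨k, hk⟩ := g.exists_extend
  refine ⟨k, fun x ↦ ?_⟩
  have h1 : k (d x) = g (d.rangeRestrict x) := LinearMap.congr_fun hk (d.rangeRestrict x)
  rw [h1]
  exact congrArg Subtype.val (LinearMap.congr_fun hg (d.rangeRestrict x))

/-- If `d` is exact in positive degrees, then each cycle of the total differential is homologous
to one in `S ⊗ M`, where `M` contains the cycles of degree zero of `d`. -/
theorem exists_sub_totalD_mem {L : σ → Module.End K N} {d : Module.End K N}
    (hL : ∀ v w x, L v (L w x) = - L w (L v x)) (hsq : ∀ v x, L v (L v x) = 0)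
    (hd : ∀ x, d (d x) = 0) (hdL : ∀ v x, d (L v x) = - L v (d x))
    {ρ : ℕ → Module.End K N} (hρ : ∀ m n x, ρ m (ρ n x) = if m = n then ρ n x else 0)
    (hρd : ∀ n x, ρ (n + 1) (d x) = d (ρ n x))
    (hρL : ∀ n v x, ρ n (L v x) = L v (ρ n x))
    (hρsum : ∀ x, ∃ J, ∀ J' ≥ J, ∑ n ∈ Finset.range J', ρ n x = x)
    {M : Submodule K N} (hM : ∀ x, d (ρ 0 x) = 0 → ρ 0 x ∈ M)
    (hex : ∀ n x, d (ρ (n + 1) x) = 0 → ∃ y, d y = ρ (n + 1) x)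
    {p : MvPolynomial σ K ⊗[K] N} (hp : totalD L d p = 0) :
    ∃ q, p - totalD L d q ∈ LinearMap.range (M.subtype.baseChange (MvPolynomial σ K)) := by
  obtain ⟨k, hk⟩ := exists_pseudoinverse d
  let B : Module.End K N → Module.End K (MvPolynomial σ K ⊗[K] N) :=
    fun f ↦ f.lTensor (MvPolynomial σ K)
  have hB : ∀ f g : Module.End K N, ∀ p, B f (B g p) = B (f ∘ₗ g) p := fun f g p ↦ by
    simp only [B, LinearMap.lTensor_comp, LinearMap.comp_apply]
  have hBd : ∀ q, totalD L d q = B d q + cartan L q := fun q ↦ rfl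
  have hBρL : ∀ n q, B (ρ n) (cartan L q) = cartan L (B (ρ n) q) := by
    intro n q
    induction q with
    | zero => simp
    | add p q hp hq => simp [hp, hq]
    | tmul s x => simp [B, cartan_tmul, hρL]
  have hBρd : ∀ n q, B (ρ (n + 1)) (B d q) = B d (B (ρ n) q) := fun n q ↦ by
    rw [hB, hB, show ρ (n + 1) ∘ₗ d = d ∘ₗ ρ n from LinearMap.ext fun x ↦ hρd n x]
  have hBρ : ∀ m n q, B (ρ m) (B (ρ n) q) = if m = n then B (ρ n) q else 0 := fun m n q ↦ by
    rw [hB]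
    split_ifs with h
    · rw [show ρ m ∘ₗ ρ n = ρ n from LinearMap.ext fun x ↦ by simp [hρ, h]]
    · rw [show ρ m ∘ₗ ρ n = 0 from LinearMap.ext fun x ↦ by simp [hρ, h]]
      simp [B]
  -- exactness after tensoring
  have hcyc : ∀ x, d (x - k (d x)) = 0 := fun x ↦ by rw [map_sub, hk, sub_self]
  have hcycρ : ∀ n x, d (ρ n (x - k (d x))) = 0 := fun n x ↦ by
    rw [← hρd, hcyc, map_zero]
  -- `id - k ∘ d` is a projection onto the cycles of `d`. On positive-degree components of its
  -- values `d ∘ k` is the identity, and this operator identity survives tensoring.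
  have hBex : ∀ n q, B d q = 0 → B d (B k (B (ρ (n + 1)) q)) = B (ρ (n + 1)) q := by
    intro n q hq
    have e : (d ∘ₗ k) ∘ₗ (ρ (n + 1) ∘ₗ (LinearMap.id - k ∘ₗ d)) =
        ρ (n + 1) ∘ₗ (LinearMap.id - k ∘ₗ d) := by
      refine LinearMap.ext fun x ↦ ?_
      obtain ⟨y, hy⟩ := hex n _ (hcycρ (n + 1) x)
      simp only [LinearMap.comp_apply, LinearMap.sub_apply, LinearMap.id_apply]
      rw [← hy, hk]
    have e2 : B (LinearMap.id - k ∘ₗ d) q = q := by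
      have : B (LinearMap.id - k ∘ₗ d) q = q - B k (B d q) := by
        rw [hB]
        simp [B, LinearMap.lTensor_sub]
      rw [this, hq, map_zero, sub_zero]
    have := congrArg (fun f ↦ B f q) e
    simp only [← hB] at this
    rwa [e2] at this
  have hBM : ∀ q, B d q = 0 → B (ρ 0) q ∈
      LinearMap.range (M.subtype.baseChange (MvPolynomial σ K)) := by
    intro q hq
    let f : N →ₗ[K] M := LinearMap.codRestrict M (ρ 0 ∘ₗ (LinearMap.id - k ∘ₗ d))
      fun x ↦ hM _ (hcycρ 0 x)
    refine ⟨f.lTensor _ q, ?_⟩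
    have e2 : B (ρ 0 ∘ₗ (LinearMap.id - k ∘ₗ d)) q = B (ρ 0) q := by
      have : B (LinearMap.id - k ∘ₗ d) q = q - B k (B d q) := by
        rw [hB]
        simp [B, LinearMap.lTensor_sub]
      rw [← hB, this, hq, map_zero, sub_zero]
    rw [← e2]
    change (M.subtype.lTensor _) (f.lTensor _ q) = _
    rw [← LinearMap.comp_apply, ← LinearMap.lTensor_comp]
    rfl
  have hBsum : ∀ q, ∃ J, ∀ J' ≥ J, ∑ n ∈ Finset.range J', B (ρ n) q = q := by
    intro q
    induction q with
    | zero => exact ⟨0, by simp⟩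
    | add p q hp hq =>
      obtain ⟨J, hJ⟩ := hp
      obtain ⟨J', hJ'⟩ := hq
      refine ⟨max J J', fun n hn ↦ ?_⟩
      simp only [map_add, Finset.sum_add_distrib]
      rw [hJ n (le_trans (le_max_left _ _) hn), hJ' n (le_trans (le_max_right _ _) hn)]
    | tmul s x =>
      obtain ⟨J, hJ⟩ := hρsum x
      refine ⟨J, fun n hn ↦ ?_⟩
      simp only [B, LinearMap.lTensor_tmul]
      rw [← TensorProduct.tmul_sum, hJ n hn]
  obtain ⟨J, hJ⟩ := hBsum p
  replace hJ : ∑ n ∈ Finset.range (J + 1), B (ρ n) p = p := hJ _ (by omega)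
  induction J generalizing p with
  | zero =>
    rw [Finset.sum_range_one] at hJ
    refine ⟨0, ?_⟩
    rw [map_zero, sub_zero, ← hJ]
    refine hBM p ?_
    have := congrArg (B (ρ 1)) hp
    rw [hBd, map_add, hBρd, hBρL, hJ, map_zero] at this
    rwa [show B (ρ 1) p = 0 by rw [← hJ, hBρ, if_neg (by omega)], map_zero, add_zero] at this
  | succ J ih =>
    have hvan : ∀ n ≥ J + 2, B (ρ n) p = 0 := by
      intro n hn
      rw [← hJ, map_sum]
      refine Finset.sum_eq_zero fun m hm ↦ ?_
      rw [hBρ, if_neg]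
      have := Finset.mem_range.1 hm
      omega
    have hz : B d (B (ρ (J + 1)) p) = 0 := by
      have := congrArg (B (ρ (J + 2))) hp
      rwa [hBd, map_add, hBρd, hBρL, hvan (J + 2) le_rfl, map_zero, map_zero, add_zero] at this
    -- A primitive of the leading component, cut down to degree `J`, so that the Cartan part of
    -- `totalD L d r` creates nothing above degree `J`.
    set r := B (ρ J) (B k (B (ρ (J + 1)) p)) with hr
    have hdr : B d r = B (ρ (J + 1)) p := by
      have h1 := hBex J _ hz
      rw [hBρ, if_pos rfl] at h1
      rw [hr, ← hBρd, h1, hBρ, if_pos rfl]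
    have hrr : B (ρ J) (cartan L r) = cartan L r := by
      rw [hBρL, hr, hBρ, if_pos rfl]
    obtain ⟨q, hq⟩ := ih (p := p - totalD L d r)
      (by rw [map_sub, hp, totalD_totalD hL hsq hd hdL, sub_zero]) (by
        have e : ∀ n, B (ρ n) (p - totalD L d r) = B (ρ n) p - B (ρ n) (B (ρ (J + 1)) p) -
            B (ρ n) (B (ρ J) (cartan L r)) := by
          intro n
          rw [hBd, hdr, hrr]
          simp only [map_sub, map_add]
          abel
        simp only [e, Finset.sum_sub_distrib]
        rw [Finset.sum_range_succ] at hJ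
        have h1 : ∑ n ∈ Finset.range (J + 1), B (ρ n) (B (ρ (J + 1)) p) = 0 :=
          Finset.sum_eq_zero fun n hn ↦ by
            rw [hBρ, if_neg]
            have := Finset.mem_range.1 hn
            omega
        have h2 : ∑ n ∈ Finset.range (J + 1), B (ρ n) (B (ρ J) (cartan L r)) =
            B (ρ J) (cartan L r) := by
          rw [Finset.sum_eq_single J]
          · rw [hBρ, if_pos rfl]
          · intro n _ hn
            rw [hBρ, if_neg hn]
          · simp
        rw [h1, h2, hBd, hdr, hrr, eq_sub_of_add_eq hJ]
        abel)
    refine ⟨r + q, ?_⟩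
    rwa [map_add, ← sub_sub]

end TotalComplex

/-! ### Finite-dimensional homology from annihilation by the variables. -/

section Koszul

open MvPolynomial

/-- If the cycles of an endomorphism of a noetherian module over a polynomial ring are sent to
boundaries by the variables, then the homology is finite-dimensional. -/
theorem exists_finset_cycles {K σ : Type*} [Field K] {N : Type*} [AddCommGroup N]
    [Module K N] [Module (MvPolynomial σ K) N] [IsScalarTower K (MvPolynomial σ K) N]
    [IsNoetherian (MvPolynomial σ K) N] (κ : N →ₗ[MvPolynomial σ K] N)
    (h : ∀ v z, κ z = 0 → ∃ w, κ w = (X v : MvPolynomial σ K) • z) :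
    ∃ Y : Finset N, ∀ z, κ z = 0 → ∃ y ∈ Submodule.span K (Y : Set N), ∃ w, z = y + κ w := by
  obtain ⟨Y, hY⟩ := IsNoetherian.noetherian (LinearMap.ker κ)
  refine ⟨Y, fun z hz ↦ ?_⟩
  -- Modulo boundaries, a polynomial acts on a cycle through its constant term, so generators of the
  -- cycles over the polynomial ring span the homology over `K`.
  have hs : ∀ (s : MvPolynomial σ K) (y : N), κ y = 0 → ∃ w, s • y = constantCoeff s • y + κ w := by
    intro s y hy
    induction s using MvPolynomial.induction_on with
    | C a => exact ⟨0, by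
      rw [constantCoeff_C, map_zero, add_zero, ← algebraMap_eq, algebraMap_smul]⟩
    | add p q hp hq =>
      obtain ⟨w, hw⟩ := hp
      obtain ⟨w', hw'⟩ := hq
      exact ⟨w + w', by rw [add_smul, hw, hw', map_add, map_add, add_smul]; abel⟩
    | mul_X p v _ =>
      obtain ⟨w, hw⟩ := h v y hy
      exact ⟨p • w, by simp [mul_smul, hw]⟩
  have hz' : z ∈ Submodule.span (MvPolynomial σ K) (Y : Set N) := by
    rw [hY]
    exact hz
  induction hz' using Submodule.span_induction with
  | mem y hy => exact ⟨y, Submodule.subset_span hy, 0, by simp⟩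
  | zero => exact ⟨0, zero_mem _, 0, by simp⟩
  | add a b ha hb iha ihb =>
    rw [hY] at ha hb
    obtain ⟨y, hy, w, rfl⟩ := iha ha
    obtain ⟨y', hy', w', rfl⟩ := ihb hb
    exact ⟨y + y', add_mem hy hy', w + w', by rw [map_add]; abel⟩
  | smul s a ha iha =>
    rw [hY] at ha
    obtain ⟨y, hy, w, hw⟩ := iha ha
    obtain ⟨w', hw'⟩ := hs s a ha
    refine ⟨constantCoeff s • y, Submodule.smul_mem _ _ hy,
      (C (constantCoeff s) : MvPolynomial σ K) • w + w', ?_⟩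
    rw [hw', map_add, map_smul, ← add_assoc]
    conv_lhs => rw [hw]
    rw [smul_add, ← algebraMap_eq, algebraMap_smul]

end Koszul

/-! ### Commutation, contraction and linear parts in the exterior algebra. -/

namespace ExteriorAlgebra

variable {K : Type u} [Field K] {V : Type v} [AddCommGroup V] [Module K V]

open CliffordAlgebra (involute contractLeft reverse)

theorem mul_ι_eq_ι_mul_involute (y : ExteriorAlgebra K V) (x : V) :
    y * ι K x = ι K x * involute y := by
  induction y using ExteriorAlgebra.induction with
  | algebraMap r => rw [AlgHom.commutes, Algebra.commutes]
  | ι m =>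
    rw [CliffordAlgebra.involute_ι, mul_neg]
    exact eq_neg_of_add_eq_zero_left (ι_add_mul_swap m x)
  | mul a b ha hb => rw [mul_assoc, hb, ← mul_assoc, ha, mul_assoc, map_mul]
  | add a b ha hb => rw [add_mul, ha, hb, map_add, mul_add]

theorem ι_mul_eq_involute_mul_ι (y : ExteriorAlgebra K V) (x : V) :
    ι K x * y = involute y * ι K x := by
  rw [mul_ι_eq_ι_mul_involute, CliffordAlgebra.involute_involute]

theorem ι_mul_ι_mul (x x' : V) (y : ExteriorAlgebra K V) :
    ι K x * (ι K x' * y) = - (ι K x' * (ι K x * y)) := by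
  rw [← mul_assoc, ← mul_assoc, ← neg_mul]
  congr 1
  exact eq_neg_of_add_eq_zero_left (ι_add_mul_swap x x')

theorem ι_mul_ι_mul_self (x : V) (y : ExteriorAlgebra K V) : ι K x * (ι K x * y) = 0 := by
  rw [← mul_assoc, ι_sq_zero, zero_mul]

theorem contractLeft_ι_mul_add (f : Module.Dual K V) (x : V) (y : ExteriorAlgebra K V) :
    contractLeft f (ι K x * y) + ι K x * contractLeft f y = f x • y := by
  rw [show contractLeft f (ι K x * y) = _ from CliffordAlgebra.contractLeft_ι_mul f x y]
  exact sub_add_cancel _ _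

theorem involute_contractLeft (f : Module.Dual K V) (y : ExteriorAlgebra K V) :
    involute (contractLeft f y) = - contractLeft f (involute y) := by
  induction y using CliffordAlgebra.left_induction with
  | algebraMap r => simp [CliffordAlgebra.contractLeft_algebraMap]
  | add a b ha hb => simp only [map_add, ha, hb, neg_add]
  | ι_mul a x ha =>
    simp only [CliffordAlgebra.contractLeft_ι_mul, map_sub, map_mul, map_smul, ha,
      CliffordAlgebra.involute_ι, neg_mul, map_neg, mul_neg]
    simp only [neg_sub, neg_neg]

theorem ι_mem_one (x : V) : ι K x ∈ ⋀[K]^1 V := by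
  rw [show ⋀[K]^1 V = LinearMap.range (ι K) from pow_one _]
  exact LinearMap.mem_range_self _ x

theorem proj_zero_ι_mul (x : V) (y : ExteriorAlgebra K V) :
    GradedAlgebra.proj (fun i : ℕ ↦ ⋀[K]^i V) 0 (ι K x * y) = 0 := by
  rw [GradedAlgebra.proj_apply]
  exact DirectSum.coe_decompose_mul_of_left_mem_of_not_le _ (ι_mem_one x) (by omega)

theorem proj_succ_ι_mul (i : ℕ) (x : V) (y : ExteriorAlgebra K V) :
    GradedAlgebra.proj (fun i : ℕ ↦ ⋀[K]^i V) (i + 1) (ι K x * y) =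
      ι K x * GradedAlgebra.proj (fun i : ℕ ↦ ⋀[K]^i V) i y := by
  rw [GradedAlgebra.proj_apply, GradedAlgebra.proj_apply, add_comm i 1]
  exact DirectSum.coe_decompose_mul_add_of_left_mem _ (ι_mem_one x)

theorem ι_mul_mem_maxIdeal (x : V) (y : ExteriorAlgebra K V) : ι K x * y ∈ maxIdeal K V :=
  (HomogeneousIdeal.mem_irrelevant_iff _ _).2 (proj_zero_ι_mul x y)

theorem proj_zero_algebraMap (k : K) :
    GradedAlgebra.proj (fun i : ℕ ↦ ⋀[K]^i V) 0 (algebraMap K (ExteriorAlgebra K V) k) =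
      algebraMap K _ k := by
  rw [GradedAlgebra.proj_apply]
  exact DirectSum.decompose_of_mem_same _ (SetLike.algebraMap_mem_graded _ k)

variable {σ : Type*} (b : Module.Basis σ K V)

theorem algebraMapInv_ι_mul (x : V) (y : ExteriorAlgebra K V) :
    algebraMapInv (ι K x * y) = 0 := by
  simp [algebraMapInv]

/-- The coefficient of an element of the exterior algebra at a basis vector. -/
noncomputable def linCoeff (v : σ) : ExteriorAlgebra K V →ₗ[K] K :=
  algebraMapInv.toLinearMap ∘ₗ contractLeft (b.coord v)

theorem linCoeff_ι_mul [DecidableEq σ] (v w : σ) (y : ExteriorAlgebra K V) :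
    linCoeff b v (ι K (b w) * y) = if v = w then algebraMapInv y else 0 := by
  have h : contractLeft (b.coord v) (ι K (b w) * y) =
      b.coord v (b w) • y - ι K (b w) * contractLeft (b.coord v) y :=
    CliffordAlgebra.contractLeft_ι_mul _ _ _
  rw [linCoeff, LinearMap.comp_apply, h, AlgHom.toLinearMap_apply, map_sub, algebraMapInv_ι_mul,
    sub_zero, map_smul, b.coord_apply, b.repr_self, Finsupp.single_apply]
  simp [eq_comm]

variable [Fintype σ]

theorem exists_eq_algebraMap_add_sum (a : ExteriorAlgebra K V) :
    ∃ (k : K) (y : σ → ExteriorAlgebra K V),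
      a = algebraMap K _ k + ∑ v, ι K (b v) * y v := by
  induction a using CliffordAlgebra.left_induction with
  | algebraMap r => exact ⟨r, 0, by simp⟩
  | add a c ha hc =>
    obtain ⟨k, y, rfl⟩ := ha
    obtain ⟨k', y', rfl⟩ := hc
    refine ⟨k + k', y + y', ?_⟩
    simp only [map_add, Pi.add_apply, mul_add, Finset.sum_add_distrib]
    abel
  | ι_mul a x _ =>
    refine ⟨0, fun v ↦ b.repr x v • a, ?_⟩
    change ι K x * a = _
    conv_lhs => rw [← b.sum_repr x]
    rw [map_sum, Finset.sum_mul, map_zero, zero_add]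
    exact Finset.sum_congr rfl fun v _ ↦ by rw [map_smul, smul_mul_assoc, mul_smul_comm]

theorem mem_maxIdeal_iff [FiniteDimensional K V] (a : ExteriorAlgebra K V) :
    a ∈ maxIdeal K V ↔ algebraMapInv a = 0 := by
  obtain ⟨k, y, rfl⟩ := exists_eq_algebraMap_add_sum (Module.Free.chooseBasis K V) a
  have h1 : GradedAlgebra.proj (fun i : ℕ ↦ ⋀[K]^i V) 0 (algebraMap K _ k +
      ∑ v, ι K (Module.Free.chooseBasis K V v) * y v) = algebraMap K _ k := by
    rw [map_add, map_sum, proj_zero_algebraMap, Finset.sum_eq_zero, add_zero]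
    exact fun v _ ↦ proj_zero_ι_mul _ _
  have h2 : algebraMapInv (algebraMap K _ k +
      ∑ v, ι K (Module.Free.chooseBasis K V v) * y v) = k := by
    rw [map_add, map_sum, Finset.sum_eq_zero, add_zero]
    · exact algebraMap_leftInverse V k
    · exact fun v _ ↦ algebraMapInv_ι_mul _ _
  have h3 : algebraMap K _ k + ∑ v, ι K (Module.Free.chooseBasis K V v) * y v ∈ maxIdeal K V ↔
      GradedAlgebra.proj (fun i : ℕ ↦ ⋀[K]^i V) 0 (algebraMap K _ k +
        ∑ v, ι K (Module.Free.chooseBasis K V v) * y v) = 0 :=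
    HomogeneousIdeal.mem_irrelevant_iff _ _
  rw [h3, h1, h2]
  exact algebraMap_eq_zero_iff V k

theorem mem_maxIdeal_iff_of_basis (b : Module.Basis σ K V) (a : ExteriorAlgebra K V) :
    a ∈ maxIdeal K V ↔ algebraMapInv a = 0 :=
  have := Module.Finite.of_basis b
  mem_maxIdeal_iff a

/-- A normal form separating the linear part from the square of the maximal ideal. -/
theorem exists_eq_sum_of_mem_maxIdeal {a : ExteriorAlgebra K V} (ha : a ∈ maxIdeal K V) :
    ∃ (k : σ → K) (z : σ → σ → ExteriorAlgebra K V),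
      a = ∑ v, k v • ι K (b v) + ∑ v, ∑ w, ι K (b v) * (ι K (b w) * z v w) := by
  obtain ⟨k, y, rfl⟩ := exists_eq_algebraMap_add_sum b a
  have hk : k = 0 := by
    have := (mem_maxIdeal_iff_of_basis b _).1 ha
    rwa [map_add, map_sum, Finset.sum_eq_zero fun v _ ↦ algebraMapInv_ι_mul _ _, add_zero,
      algebraMap_leftInverse V k] at this
  choose k' z hz using fun v ↦ exists_eq_algebraMap_add_sum b (y v)
  refine ⟨k', z, ?_⟩
  rw [hk, map_zero, zero_add, ← Finset.sum_add_distrib]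
  refine Finset.sum_congr rfl fun v _ ↦ ?_
  conv_lhs => rw [hz v]
  rw [mul_add, Finset.mul_sum, ← Algebra.commutes, ← Algebra.smul_def]

theorem linElem_ι (x : V) : linElem (ι K x) = ι K x := by
  have h0 := proj_zero_ι_mul (K := K) x 1
  have h1 := proj_succ_ι_mul (K := K) 0 x 1
  have h2 := proj_zero_algebraMap (V := V) (1 : K)
  rw [map_one] at h2
  rw [h2, mul_one] at h1
  rw [mul_one] at h0
  rw [linElem, LinearMap.add_apply, h0, h1, zero_add]

theorem linElem_ι_mul_ι_mul (x x' : V) (y : ExteriorAlgebra K V) :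
    linElem (ι K x * (ι K x' * y)) = 0 := by
  rw [linElem, LinearMap.add_apply, proj_zero_ι_mul, proj_succ_ι_mul, proj_zero_ι_mul, mul_zero,
    zero_add]

theorem linElem_sum (k : σ → K) (z : σ → σ → ExteriorAlgebra K V) :
    linElem (∑ v, k v • ι K (b v) + ∑ v, ∑ w, ι K (b v) * (ι K (b w) * z v w)) =
      ∑ v, k v • ι K (b v) := by
  simp only [map_add, map_sum, map_smul, linElem_ι, linElem_ι_mul_ι_mul, Finset.sum_const_zero,
    add_zero]

theorem linElem_eq_sum_linCoeff {a : ExteriorAlgebra K V} (ha : a ∈ maxIdeal K V) :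
    linElem a = ∑ v, linCoeff b v a • ι K (b v) := by
  classical
  obtain ⟨k, z, rfl⟩ := exists_eq_sum_of_mem_maxIdeal b ha
  rw [linElem_sum]
  refine Finset.sum_congr rfl fun v _ ↦ ?_
  congr 1
  have h1 : ∀ w, linCoeff b v (ι K (b w)) = if v = w then 1 else 0 := fun w ↦ by
    rw [← mul_one (ι K (b w)), linCoeff_ι_mul, map_one]
  simp [linCoeff_ι_mul, algebraMapInv_ι_mul, h1]

/-- An element annihilated by all products of two vectors cannot see the quadratic remainder in the
normal form of `a`. -/
theorem mul_eq_mul_linElem {u : ExteriorAlgebra K V}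
    (hu : ∀ v w, u * ι K (b v) * ι K (b w) = 0) {a : ExteriorAlgebra K V}
    (ha : a ∈ maxIdeal K V) : u * a = u * linElem a := by
  obtain ⟨k, z, rfl⟩ := exists_eq_sum_of_mem_maxIdeal b ha
  rw [linElem_sum, mul_add, add_eq_left, Finset.mul_sum]
  refine Finset.sum_eq_zero fun v _ ↦ ?_
  rw [Finset.mul_sum]
  refine Finset.sum_eq_zero fun w _ ↦ ?_
  rw [← mul_assoc, ← mul_assoc, hu, zero_mul]

theorem mul_eq_zero_of_mem_maxIdeal {u : ExteriorAlgebra K V}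
    (hu : ∀ v, u * ι K (b v) = 0) {a : ExteriorAlgebra K V} (ha : a ∈ maxIdeal K V) :
    u * a = 0 := by
  rw [mul_eq_mul_linElem b (fun v w ↦ by rw [hu, zero_mul]) ha, linElem_eq_sum_linCoeff b ha,
    Finset.mul_sum]
  exact Finset.sum_eq_zero fun v _ ↦ by rw [mul_smul_comm, hu, smul_zero]

/-- Moving a vector across costs only the grade involution, which is injective. -/
theorem mul_ι_eq_zero_iff {u : ExteriorAlgebra K V} (x : V) :
    u * ι K x = 0 ↔ ι K x * u = 0 := by
  rw [ι_mul_eq_involute_mul_ι, mul_ι_eq_ι_mul_involute,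
    ← CliffordAlgebra.involute_involutive.injective.eq_iff (a := involute u * ι K x), map_mul,
    CliffordAlgebra.involute_involute, CliffordAlgebra.involute_ι, mul_neg, map_zero, neg_eq_zero,
    mul_ι_eq_ι_mul_involute]

theorem mul_eq_algebraMapInv_smul {u : ExteriorAlgebra K V}
    (hu : ∀ v, u * ι K (b v) = 0) (a : ExteriorAlgebra K V) :
    u * a = algebraMapInv a • u := by
  obtain ⟨k, y, rfl⟩ := exists_eq_algebraMap_add_sum b a
  rw [map_add, map_sum, Finset.sum_eq_zero fun v _ ↦ algebraMapInv_ι_mul _ _, add_zero,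
    algebraMap_leftInverse V k, mul_add, Finset.mul_sum, Finset.sum_eq_zero, add_zero,
    ← Algebra.commutes, ← Algebra.smul_def]
  exact fun v _ ↦ by rw [← mul_assoc, hu, zero_mul]

/-- Reversion fixes vectors and, products of two vectors being central, preserves the remainder in
the normal form. This makes the duality below compatible with minimality and linear parts. -/
theorem reverse_mem_maxIdeal [FiniteDimensional K V] {a : ExteriorAlgebra K V}
    (ha : a ∈ maxIdeal K V) : reverse a ∈ maxIdeal K V ∧
      linElem (reverse a) = reverse (linElem a) := by
  let b := Module.Free.chooseBasis K V
  obtain ⟨k, z, rfl⟩ := exists_eq_sum_of_mem_maxIdeal b ha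
  rw [linElem_sum]
  have h : reverse (∑ v, k v • ι K (b v) + ∑ v, ∑ w, ι K (b v) * (ι K (b w) * z v w)) =
      ∑ v, k v • ι K (b v) + ∑ v, ∑ w, ι K (b v) * (ι K (b w) * reverse (z w v)) := by
    simp only [map_add, map_sum, map_smul, CliffordAlgebra.reverse.map_mul]
    rw [Finset.sum_comm (f := fun v w ↦ ι K (b v) * (ι K (b w) * reverse (z w v)))]
    congr 1
    · simp only [show ∀ v, reverse (ι K (b v)) = ι K (b v) from
        fun v ↦ CliffordAlgebra.reverse_ι _]
    · refine Finset.sum_congr rfl fun v _ ↦ Finset.sum_congr rfl fun w _ ↦ ?_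
      rw [show ∀ v, reverse (ι K (b v)) = ι K (b v) from fun v ↦ CliffordAlgebra.reverse_ι _,
        show ∀ v, reverse (ι K (b v)) = ι K (b v) from fun v ↦ CliffordAlgebra.reverse_ι _,
        mul_ι_eq_ι_mul_involute (reverse (z v w)), mul_assoc, mul_ι_eq_ι_mul_involute,
        CliffordAlgebra.involute_involute]
  rw [h, linElem_sum]
  refine ⟨add_mem (sum_mem fun v _ ↦ ?_) (sum_mem fun v _ ↦ sum_mem fun w _ ↦
    ι_mul_mem_maxIdeal _ _), ?_⟩
  · rw [Algebra.smul_def, Algebra.commutes]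
    exact ι_mul_mem_maxIdeal _ _
  · simp only [map_sum, map_smul, show ∀ v, reverse (ι K (b v)) = ι K (b v) from
        fun v ↦ CliffordAlgebra.reverse_ι _]

end ExteriorAlgebra

/-! ### Socle, Frobenius functional and locality of the exterior algebra. -/

namespace ExteriorAlgebra

variable {K : Type u} [Field K] {V : Type v} [AddCommGroup V] [Module K V]
  {σ : Type*} (b : Module.Basis σ K V)

open CliffordAlgebra (involute contractLeft reverse)

theorem involute_list_prod (l : List σ) :
    ∃ s : K, involute (l.map fun v ↦ ι K (b v)).prod =
      s • (l.map fun v ↦ ι K (b v)).prod := by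
  induction l with
  | nil => exact ⟨1, by simp⟩
  | cons v l ih =>
    obtain ⟨s, h⟩ := ih
    refine ⟨-s, ?_⟩
    rw [List.map_cons, List.prod_cons, map_mul, h, CliffordAlgebra.involute_ι]
    simp

theorem ι_mul_list_prod {l : List σ} {v : σ} (hv : v ∈ l) :
    ι K (b v) * (l.map fun v ↦ ι K (b v)).prod = 0 := by
  induction l with
  | nil => simp at hv
  | cons w l ih =>
    rw [List.map_cons, List.prod_cons]
    rcases List.mem_cons.1 hv with rfl | hv
    · exact ι_mul_ι_mul_self _ _
    · rw [ι_mul_ι_mul, ih hv, mul_zero, neg_zero]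

/-- Contraction along `v` passes each basis vector other than `b v` with a mere sign change, so
divisibility by the product is kept. -/
theorem contractLeft_list_prod_mul [DecidableEq σ] {l : List σ} {v : σ} (hv : v ∉ l)
    (y : ExteriorAlgebra K V) :
    ∃ z, contractLeft (b.coord v) ((l.map fun v ↦ ι K (b v)).prod * y) =
      (l.map fun v ↦ ι K (b v)).prod * z := by
  induction l with
  | nil => exact ⟨contractLeft (b.coord v) y, by simp⟩
  | cons w l ih =>
    obtain ⟨z, hz⟩ := ih (fun h ↦ hv (List.mem_cons_of_mem _ h))
    have hw : b.coord v (b w) = 0 := by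
      rw [b.coord_apply, b.repr_self, Finsupp.single_apply, if_neg]
      rintro rfl
      exact hv List.mem_cons_self
    refine ⟨-z, ?_⟩
    have h := contractLeft_ι_mul_add (b.coord v) (b w) ((l.map fun v ↦ ι K (b v)).prod * y)
    rw [hw, zero_smul, hz] at h
    rw [List.map_cons, List.prod_cons, mul_assoc, eq_neg_of_add_eq_zero_left h, mul_assoc, mul_neg,
      mul_neg]

variable [Fintype σ]

/-- Every nonzero vector of a module over the exterior algebra has a nonzero multiple that is
annihilated by the maximal ideal. -/
theorem exists_smul_ne_zero {M : Type*} [AddCommGroup M] [Module (ExteriorAlgebra K V) M]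
    {x : M} (hx : x ≠ 0) :
    ∃ a : ExteriorAlgebra K V, a • x ≠ 0 ∧ ∀ v, ι K (b v) • a • x = 0 := by
  classical
  suffices h : ∀ s : Finset σ, ∃ a : ExteriorAlgebra K V, a • x ≠ 0 ∧
      ∀ v ∈ s, ι K (b v) • a • x = 0 by
    simpa using h Finset.univ
  intro s
  induction s using Finset.induction_on with
  | empty => exact ⟨1, by simpa using hx, by simp⟩
  | insert v s _ ih =>
    obtain ⟨a, ha, has⟩ := ih
    by_cases h : ι K (b v) • a • x = 0
    · exact ⟨a, ha, by simpa [h] using has⟩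
    · refine ⟨ι K (b v) * a, by rwa [mul_smul], fun w hw ↦ ?_⟩
      rw [mul_smul, ← mul_smul (ι K (b w))]
      rcases Finset.mem_insert.1 hw with rfl | hw
      · rw [ι_sq_zero, zero_smul]
      · rw [eq_neg_of_add_eq_zero_left (ι_add_mul_swap (b w) (b v)), neg_smul, mul_smul,
          has w hw, smul_zero, neg_zero]

/-- The product of the basis vectors. -/
noncomputable def topElem : ExteriorAlgebra K V :=
  ((Finset.univ : Finset σ).toList.map fun v ↦ ι K (b v)).prod

theorem involute_topElem : ∃ s : K, involute (topElem b) = s • topElem b :=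
  involute_list_prod b _

theorem ι_mul_topElem (v : σ) : ι K (b v) * topElem b = 0 :=
  ι_mul_list_prod b (by simp)

theorem topElem_mul_ι (v : σ) : topElem b * ι K (b v) = 0 :=
  (mul_ι_eq_zero_iff _).2 (ι_mul_topElem b v)

/-- If `e_v x = 0`, then `x` is `e_v` times its contraction along `v`; this splits off the basis
vectors one after another. -/
theorem exists_eq_topElem_mul {x : ExteriorAlgebra K V} (hx : ∀ v, ι K (b v) * x = 0) :
    ∃ y, x = topElem b * y := by
  classical
  suffices h : ∀ l : List σ, l.Nodup → ∃ y, x = (l.map fun v ↦ ι K (b v)).prod * y from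
    h _ (Finset.nodup_toList _)
  intro l hl
  induction l with
  | nil => exact ⟨x, by simp⟩
  | cons v l ih =>
    obtain ⟨y, hy⟩ := ih hl.of_cons
    obtain ⟨z, hz⟩ := contractLeft_list_prod_mul b (List.nodup_cons.1 hl).1 y
    refine ⟨z, ?_⟩
    have h := contractLeft_ι_mul_add (b.coord v) (b v) x
    rw [hx, map_zero, zero_add] at h
    conv_rhs at h => rw [b.coord_apply, b.repr_self, Finsupp.single_eq_same, one_smul]
    rw [List.map_cons, List.prod_cons, mul_assoc, ← hz, ← hy, h]

/-- The socle of the exterior algebra is spanned by the product of the basis vectors. -/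
theorem exists_eq_smul_topElem {x : ExteriorAlgebra K V} (hx : ∀ v, ι K (b v) * x = 0) :
    ∃ k : K, x = k • topElem b := by
  obtain ⟨y, rfl⟩ := exists_eq_topElem_mul b hx
  exact ⟨_, mul_eq_algebraMapInv_smul b (topElem_mul_ι b) y⟩

theorem topElem_ne_zero : topElem b ≠ 0 := by
  intro h
  obtain ⟨a, ha, has⟩ := exists_smul_ne_zero b (one_ne_zero (α := ExteriorAlgebra K V))
  obtain ⟨k, hk⟩ := exists_eq_smul_topElem b (x := a • 1) has
  exact ha (by rw [hk, h, smul_zero])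

instance [FiniteDimensional K V] : FiniteDimensional K (ExteriorAlgebra K V) :=
  Module.Finite.of_basis (Module.finBasis K V).ExteriorAlgebra

/-- A linear functional on the exterior algebra inducing a perfect pairing. -/
theorem exists_functional (K : Type u) [Field K] (V : Type v) [AddCommGroup V] [Module K V]
    [FiniteDimensional K V] :
    ∃ f : Module.Dual K (ExteriorAlgebra K V), ∀ x, (∀ a, f (a * x) = 0) → x = 0 := by
  let b := Module.Free.chooseBasis K V
  obtain ⟨f, hf⟩ : ∃ f : Module.Dual K (ExteriorAlgebra K V), f (topElem b) ≠ 0 := by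
    by_contra! h
    exact topElem_ne_zero b ((Module.forall_dual_apply_eq_zero_iff K _).1 h)
  refine ⟨f, fun x hx ↦ ?_⟩
  by_contra hx0
  obtain ⟨a, ha, has⟩ := exists_smul_ne_zero b hx0
  obtain ⟨k, hk⟩ := exists_eq_smul_topElem b has
  have h := hx a
  rw [← smul_eq_mul, hk, map_smul, smul_eq_zero] at h
  rcases h with h | h
  · exact ha (by rw [hk, h, zero_smul])
  · exact hf h

theorem isUnit_of_notMem_maxIdeal [FiniteDimensional K V] {a : ExteriorAlgebra K V}
    (ha : a ∉ maxIdeal K V) : IsUnit a := by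
  let b := Module.Free.chooseBasis K V
  have key : ∀ a : ExteriorAlgebra K V, a ∉ maxIdeal K V → ∃ c, c * a = 1 := by
    intro a ha
    -- If `x * a = 0` with `x ≠ 0`, some nonzero multiple of `x` lies in the socle, where right
    -- multiplication by `a` is scaling by the nonzero constant term of `a`.
    have hinj : Function.Injective (LinearMap.mulRight K a) := by
      rw [← LinearMap.ker_eq_bot, LinearMap.ker_eq_bot']
      intro x hx
      by_contra hx0
      obtain ⟨c, hc, hcs⟩ := exists_smul_ne_zero b hx0
      have h1 := mul_eq_algebraMapInv_smul b
        (fun v ↦ (mul_ι_eq_zero_iff (u := c • x) (b v)).2 (hcs v)) a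
      have h2 : c • x * a = 0 := by
        rw [smul_eq_mul, mul_assoc]
        exact (congrArg (c * ·) hx).trans (mul_zero c)
      rw [h2, eq_comm, smul_eq_zero] at h1
      rcases h1 with h1 | h1
      · exact ha ((mem_maxIdeal_iff a).2 h1)
      · exact hc h1
    obtain ⟨c, hc⟩ := LinearMap.surjective_of_injective hinj 1
    exact ⟨c, hc⟩
  obtain ⟨c, hc⟩ := key a ha
  -- The left inverse `c` lies outside the maximal ideal too, so it has a left inverse of its own,
  -- which has to be `a`.
  have hc' : c ∉ maxIdeal K V := by
    rw [mem_maxIdeal_iff]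
    intro h
    have := congrArg algebraMapInv hc
    rw [map_mul, h, zero_mul, map_one] at this
    exact zero_ne_one this
  obtain ⟨a', ha'⟩ := key c hc'
  have : a' = a := by
    calc a' = a' * (c * a) := by rw [hc, mul_one]
      _ = a := by rw [← mul_assoc, ha', one_mul]
  exact ⟨⟨a, c, this ▸ ha', hc⟩, rfl⟩

end ExteriorAlgebra

/-! ### Graded free modules with signed multiplications and contractions. -/

section GradedFree

open TensorProduct
open CliffordAlgebra (involute contractLeft contractRight)
open ExteriorAlgebra (ι)

variable {K : Type u} [Field K] {V : Type v} [AddCommGroup V] [Module K V] {I : Type*}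

/-- The diagonal map with given entries. -/
noncomputable def diagMap (V : Type v) [AddCommGroup V] [Module K V] (g : I → K) :
    Module.End K (I →₀ ExteriorAlgebra K V) :=
  Finsupp.lsum K fun i ↦ g i • Finsupp.lsingle i

theorem diagMap_single (g : I → K) (i : I) (a : ExteriorAlgebra K V) :
    diagMap V g (Finsupp.single i a) = g i • Finsupp.single i a := by
  simp [diagMap]

theorem diagMap_apply (g : I → K) (x : I →₀ ExteriorAlgebra K V) (i : I) :
    diagMap V g x i = g i • x i := by
  classical
  induction x using Finsupp.induction_linear with
  | zero => simp
  | add x y hx hy => simp only [map_add, Finsupp.add_apply, hx, hy, smul_add]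
  | single j a =>
    rw [diagMap_single, Finsupp.smul_apply, Finsupp.single_apply]
    split_ifs with h
    · rw [h]
    · simp

theorem linearMap_single (d : (I →₀ ExteriorAlgebra K V) →ₗ[ExteriorAlgebra K V]
    (I →₀ ExteriorAlgebra K V)) (i : I) (a : ExteriorAlgebra K V) :
    d (Finsupp.single i a) = a • d (Finsupp.single i 1) := by
  rw [← map_smul, Finsupp.smul_single, smul_eq_mul, mul_one]

/-- Serves both degree projections and degree signs: each is diagonal with entries depending on the
degree, which `d` raises by one. -/
theorem diagMap_comm {deg : I → ℕ} {d : (I →₀ ExteriorAlgebra K V) →ₗ[ExteriorAlgebra K V]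
    (I →₀ ExteriorAlgebra K V)}
    (hdeg : ∀ i j, d (Finsupp.single i 1) j ≠ 0 → deg j = deg i + 1) {g h : I → K}
    (hgh : ∀ i j, deg j = deg i + 1 → g j = h i) (x : I →₀ ExteriorAlgebra K V) :
    diagMap V g (d x) = d (diagMap V h x) := by
  induction x using Finsupp.induction_linear with
  | zero => simp
  | add x y hx hy => simp only [map_add, hx, hy]
  | single i a =>
    rw [diagMap_single, Finsupp.smul_single, linearMap_single, linearMap_single d i (h i • a)]
    ext j
    rw [diagMap_apply, Finsupp.smul_apply, Finsupp.smul_apply, smul_eq_mul, smul_eq_mul]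
    by_cases hj : d (Finsupp.single i 1) j = 0
    · simp [hj]
    · rw [hgh i j (hdeg i j hj), smul_mul_assoc]

/-- The projection to the component of degree `n`. -/
noncomputable def degProj (K : Type u) [Field K] (V : Type v) [AddCommGroup V] [Module K V]
    (deg : I → ℕ) (n : ℕ) : Module.End K (I →₀ ExteriorAlgebra K V) :=
  diagMap V fun i ↦ if deg i = n then 1 else 0

theorem degProj_apply (deg : I → ℕ) (n : ℕ) (x : I →₀ ExteriorAlgebra K V) (i : I) :
    degProj K V deg n x i = if deg i = n then x i else 0 := by
  rw [degProj, diagMap_apply]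
  simp

theorem deg_eq_of_degProj_ne_zero {deg : I → ℕ} {n : ℕ} {x : I →₀ ExteriorAlgebra K V} {i : I}
    (h : degProj K V deg n x i ≠ 0) : deg i = n := by
  rw [degProj_apply] at h
  by_contra h'
  exact h (if_neg h')

theorem degProj_eq_self {deg : I → ℕ} {n : ℕ} {x : I →₀ ExteriorAlgebra K V}
    (h : ∀ i, x i ≠ 0 → deg i = n) : degProj K V deg n x = x := by
  ext i
  rw [degProj_apply]
  split_ifs with hi
  · rfl
  · by_contra h'
    exact hi (h i (Ne.symm h'))

theorem sum_degProj (deg : I → ℕ) (x : I →₀ ExteriorAlgebra K V) :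
    ∃ J, ∀ J' ≥ J, ∑ n ∈ Finset.range J', degProj K V deg n x = x := by
  refine ⟨x.support.sup deg + 1, fun n hn ↦ ?_⟩
  ext i
  rw [Finsupp.finsetSum_apply]
  simp only [degProj_apply]
  rw [Finset.sum_ite_eq]
  split_ifs with h
  · rfl
  · by_contra h'
    refine h (Finset.mem_range.2 ?_)
    have := Finset.le_sup (f := deg) (Finsupp.mem_support_iff.2 (Ne.symm h'))
    omega

theorem degProj_eventually_zero (deg : I → ℕ) (x : I →₀ ExteriorAlgebra K V) :
    ∃ J, ∀ n ≥ J, degProj K V deg n x = 0 := by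
  refine ⟨x.support.sup deg + 1, fun n hn ↦ ?_⟩
  ext i
  rw [degProj_apply]
  split_ifs with h
  · by_contra h'
    have := Finset.le_sup (f := deg) (Finsupp.mem_support_iff.2 h')
    omega
  · rfl

variable {σ : Type*} (b : Module.Basis σ K V)

/-- Left multiplication by a basis vector, with the sign given by the degree. -/
noncomputable def signedMul (deg : I → ℕ) (v : σ) : Module.End K (I →₀ ExteriorAlgebra K V) :=
  Finsupp.mapRange.linearMap (LinearMap.mulLeft K (ι K (b v))) ∘ₗ diagMap V fun i ↦ (-1) ^ deg i

theorem signedMul_apply (deg : I → ℕ) (v : σ) (x : I →₀ ExteriorAlgebra K V) (i : I) :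
    signedMul b deg v x i = (-1 : K) ^ deg i • (ι K (b v) * x i) := by
  rw [signedMul, LinearMap.comp_apply, Finsupp.mapRange.linearMap_apply, Finsupp.mapRange_apply,
    diagMap_apply, LinearMap.mulLeft_apply, mul_smul_comm]

/-- Contraction with a coordinate function, with the sign given by the degree. -/
noncomputable def signedContract (deg : I → ℕ) (v : σ) :
    Module.End K (I →₀ ExteriorAlgebra K V) :=
  Finsupp.mapRange.linearMap (contractLeft (b.coord v)) ∘ₗ diagMap V fun i ↦ (-1) ^ deg i

theorem signedContract_apply (deg : I → ℕ) (v : σ) (x : I →₀ ExteriorAlgebra K V) (i : I) :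
    signedContract b deg v x i = (-1 : K) ^ deg i • contractLeft (b.coord v) (x i) := by
  rw [signedContract, LinearMap.comp_apply, Finsupp.mapRange.linearMap_apply,
    Finsupp.mapRange_apply, diagMap_apply, map_smul]

theorem sign_smul_sign_smul {M : Type*} [AddCommGroup M] [Module K M] (n : ℕ) (x : M) :
    (-1 : K) ^ n • (-1 : K) ^ n • x = x := by
  rw [smul_smul, ← mul_pow, neg_one_mul, neg_neg, one_pow, one_smul]

theorem signedMul_signedMul (deg : I → ℕ) (v w : σ) (x : I →₀ ExteriorAlgebra K V) :
    signedMul b deg v (signedMul b deg w x) = - signedMul b deg w (signedMul b deg v x) := by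
  ext i
  rw [Finsupp.neg_apply]
  simp only [signedMul_apply, mul_smul_comm, sign_smul_sign_smul]
  exact ExteriorAlgebra.ι_mul_ι_mul _ _ _

theorem signedMul_signedMul_self (deg : I → ℕ) (v : σ) (x : I →₀ ExteriorAlgebra K V) :
    signedMul b deg v (signedMul b deg v x) = 0 := by
  ext i
  simp only [signedMul_apply, mul_smul_comm, sign_smul_sign_smul]
  exact ExteriorAlgebra.ι_mul_ι_mul_self _ _

theorem signedContract_signedMul [DecidableEq σ] (deg : I → ℕ) (v w : σ)
    (x : I →₀ ExteriorAlgebra K V) :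
    signedContract b deg v (signedMul b deg w x) + signedMul b deg w (signedContract b deg v x) =
      if v = w then x else 0 := by
  ext i
  rw [Finsupp.add_apply]
  simp only [signedMul_apply, signedContract_apply, mul_smul_comm, sign_smul_sign_smul, map_smul]
  rw [ExteriorAlgebra.contractLeft_ι_mul_add, b.coord_apply, b.repr_self, Finsupp.single_apply]
  split_ifs with h1 h2 h2
  · rw [one_smul]
  · exact absurd h1.symm h2
  · exact absurd h2.symm h1
  · rw [zero_smul, Finsupp.zero_apply]

theorem degProj_signedMul (deg : I → ℕ) (n : ℕ) (v : σ) (x : I →₀ ExteriorAlgebra K V) :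
    degProj K V deg n (signedMul b deg v x) = signedMul b deg v (degProj K V deg n x) := by
  ext i
  simp only [signedMul_apply, degProj_apply]
  split_ifs <;> simp

/-- By left linearity `d` commutes with left multiplication; the degree sign turns this into
anticommutation. -/
theorem signedMul_comm {deg : I → ℕ} {d : (I →₀ ExteriorAlgebra K V) →ₗ[ExteriorAlgebra K V]
    (I →₀ ExteriorAlgebra K V)}
    (hdeg : ∀ i j, d (Finsupp.single i 1) j ≠ 0 → deg j = deg i + 1) (v : σ)
    (x : I →₀ ExteriorAlgebra K V) :
    d (signedMul b deg v x) = - signedMul b deg v (d x) := by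
  have h : ∀ x, signedMul b deg v x = ι K (b v) • diagMap V (fun i ↦ (-1) ^ deg i) x := by
    intro x
    ext i
    rw [signedMul_apply, Finsupp.smul_apply, diagMap_apply, smul_eq_mul, mul_smul_comm]
  rw [h, h, map_smul, diagMap_comm hdeg (h := fun i ↦ - (-1) ^ deg i)
    (fun i j hij ↦ by rw [hij, pow_succ, mul_neg_one]), ← smul_neg, ← map_neg]
  congr 2
  ext i
  rw [Finsupp.neg_apply, diagMap_apply, diagMap_apply, neg_smul, neg_neg]

/-- The hypothesis puts all coordinates of `x` into the socle, which the matrix entries of a minimal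
map annihilate from the right as well. -/
theorem map_eq_zero_of_signedMul [Fintype σ] {deg : I → ℕ}
    {d : (I →₀ ExteriorAlgebra K V) →ₗ[ExteriorAlgebra K V] (I →₀ ExteriorAlgebra K V)}
    (hmin : ∀ i j, d (Finsupp.single i 1) j ∈ maxIdeal K V) {x : I →₀ ExteriorAlgebra K V}
    (hx : ∀ v, signedMul b deg v x = 0) : d x = 0 := by
  have h1 : ∀ v i, x i * ι K (b v) = 0 := by
    intro v i
    have h := DFunLike.congr_fun (hx v) i
    rw [signedMul_apply, Finsupp.zero_apply, smul_eq_zero] at h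
    exact (ExteriorAlgebra.mul_ι_eq_zero_iff _).2
      (h.resolve_left (pow_ne_zero _ (neg_ne_zero.2 one_ne_zero)))
  conv_lhs => rw [← Finsupp.sum_single x]
  rw [Finsupp.sum, map_sum]
  refine Finset.sum_eq_zero fun i _ ↦ ?_
  ext j
  rw [linearMap_single, Finsupp.smul_apply, smul_eq_mul]
  exact ExteriorAlgebra.mul_eq_zero_of_mem_maxIdeal b (fun v ↦ h1 v i) (hmin i j)

end GradedFree

/-! ### The noetherian module over the polynomial ring. -/

section LinearPartExact

open TensorProduct
open CliffordAlgebra (involute contractLeft contractRight)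
open ExteriorAlgebra (ι linCoeff topElem)

variable {K : Type u} [Field K] {V : Type v} [AddCommGroup V] [Module K V] {I : Type w}

/-- The linear part of an endomorphism of a free module with respect to the standard basis. -/
noncomputable abbrev linStd (d : (I →₀ ExteriorAlgebra K V) →ₗ[ExteriorAlgebra K V]
    (I →₀ ExteriorAlgebra K V)) :
    (I →₀ ExteriorAlgebra K V) →ₗ[ExteriorAlgebra K V] (I →₀ ExteriorAlgebra K V) :=
  linMap Finsupp.basisSingleOne Finsupp.basisSingleOne d

theorem linStd_single (d : (I →₀ ExteriorAlgebra K V) →ₗ[ExteriorAlgebra K V]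
    (I →₀ ExteriorAlgebra K V)) (i : I) :
    linStd d (Finsupp.single i 1) =
      Finsupp.mapRange.linearMap linElem (d (Finsupp.single i 1)) := by
  exact ((Finsupp.basisSingleOne (R := ExteriorAlgebra K V) (ι := I)).constr_basis ℕ _ i).trans
    (Finsupp.ext fun j ↦ rfl)

variable {σ : Type w'} [Fintype σ] [DecidableEq σ] (b : Module.Basis σ K V)

theorem ι_mul_contractLeft_topElem (v w : σ) :
    ι K (b w) * contractLeft (b.coord v) (topElem b) = if w = v then topElem b else 0 := by
  have h := ExteriorAlgebra.contractLeft_ι_mul_add (b.coord v) (b w) (topElem b)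
  rw [ExteriorAlgebra.ι_mul_topElem, map_zero, zero_add, b.coord_apply, b.repr_self,
    Finsupp.single_apply] at h
  rw [h]
  split_ifs <;> simp

theorem contractLeft_topElem_mul_ι {s : K} (hs : involute (topElem b) = s • topElem b) (v w : σ) :
    contractLeft (b.coord v) (topElem b) * ι K (b w) = if w = v then (-s) • topElem b else 0 := by
  rw [ExteriorAlgebra.mul_ι_eq_ι_mul_involute, ExteriorAlgebra.involute_contractLeft, hs, map_smul,
    mul_neg, mul_smul_comm, ι_mul_contractLeft_topElem]
  split_ifs <;> simp

/-- The contraction of the top element is, up to sign, the product of the basis vectors other than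
`b v`. Products of two vectors kill it, so only the coefficient of `b v` in `a` matters. -/
theorem contractLeft_topElem_mul {s : K} (hs : involute (topElem b) = s • topElem b) (v : σ)
    {a : ExteriorAlgebra K V} (ha : a ∈ maxIdeal K V) :
    contractLeft (b.coord v) (topElem b) * a = (-s * linCoeff b v a) • topElem b := by
  rw [ExteriorAlgebra.mul_eq_mul_linElem b _ ha, ExteriorAlgebra.linElem_eq_sum_linCoeff b ha,
    Finset.mul_sum, Finset.sum_eq_single v]
  · rw [mul_smul_comm, contractLeft_topElem_mul_ι b hs, if_pos rfl, smul_smul, mul_comm]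
  · intro w _ hw
    rw [mul_smul_comm, contractLeft_topElem_mul_ι b hs, if_neg hw, smul_zero]
  · simp
  · intro w w'
    rw [contractLeft_topElem_mul_ι b hs]
    split_ifs
    · rw [smul_mul_assoc, ExteriorAlgebra.topElem_mul_ι, smul_zero]
    · rw [zero_mul]

/-- The space on which the linear part of the complex is built embeds into a noetherian module
over the polynomial ring on `V`, whose multiplication by the variables is given by the
coefficients of the linear part. -/
theorem exists_noetherian_model {deg : I → ℕ}
    {d : (I →₀ ExteriorAlgebra K V) →ₗ[ExteriorAlgebra K V] (I →₀ ExteriorAlgebra K V)}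
    (hdeg : ∀ i j, d (Finsupp.single i 1) j ≠ 0 → deg j = deg i + 1)
    (hmin : ∀ i j, d (Finsupp.single i 1) j ∈ maxIdeal K V) (hd : ∀ x, d (d x) = 0)
    (M : Submodule K (I →₀ ExteriorAlgebra K V)) [FiniteDimensional K M]
    (hM : ∀ x, (∀ i, x i ≠ 0 → deg i = 0) → d x = 0 → x ∈ M)
    (hex : ∀ n x, (∀ i, x i ≠ 0 → deg i = n + 1) → d x = 0 → ∃ y, d y = x) :
    ∃ (Q : Type (max u v (max w w'))) (_ : AddCommGroup Q) (_ : Module (MvPolynomial σ K) Q)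
      (_ : Module K Q) (_ : IsScalarTower K (MvPolynomial σ K) Q)
      (_ : IsNoetherian (MvPolynomial σ K) Q) (φ : (I →₀ K) ≃ₗ[K] Q) (s : K),
      ∀ v i, (MvPolynomial.X v : MvPolynomial σ K) • φ (Finsupp.single i 1) =
        (s * (-1) ^ deg i) • φ (Finsupp.mapRange.linearMap (linCoeff b v)
          (d (Finsupp.single i 1))) := by
  set S := MvPolynomial σ K
  set N := I →₀ ExteriorAlgebra K V
  obtain ⟨s, htop⟩ := ExteriorAlgebra.involute_topElem b
  let d' : Module.End K N := d.restrictScalars K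
  let L := signedMul (I := I) b deg
  have hL : ∀ v w x, L v (L w x) = - L w (L v x) := signedMul_signedMul b deg
  have hsq : ∀ v x, L v (L v x) = 0 := signedMul_signedMul_self b deg
  have hc : ∀ v w x, signedContract b deg v (L w x) + L w (signedContract b deg v x) =
    if v = w then x else 0 := signedContract_signedMul b deg
  have hdL : ∀ v x, d' (L v x) = - L v (d' x) := signedMul_comm b hdeg
  let D := totalD L d'
  let B := LinearMap.range D
  let top : K →ₗ[K] ExteriorAlgebra K V := LinearMap.toSpanSingleton K _ (topElem b)
  let φ₀ : (I →₀ K) →ₗ[K] N := Finsupp.mapRange.linearMap top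
  -- Each free generator is sent to the class of its top multiple, so the range consists of the
  -- classes of the socle.
  let φ : (I →₀ K) →ₗ[K] (S ⊗[K] N) ⧸ B :=
    B.mkQ.restrictScalars K ∘ₗ TensorProduct.mk K S N 1 ∘ₗ φ₀
  have hφ₀a : ∀ t i, φ₀ t i = t i • topElem b := fun t i ↦ rfl
  have hφ₀ : ∀ i k, φ₀ (Finsupp.single i k) = Finsupp.single i (k • topElem b) := by
    classical
    intro i k
    ext j
    rw [hφ₀a, Finsupp.single_apply, Finsupp.single_apply]
    split_ifs <;> simp
  have hφinj : Function.Injective φ := by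
    rw [← LinearMap.ker_eq_bot, LinearMap.ker_eq_bot']
    intro t ht
    obtain ⟨p, hp⟩ : (1 : S) ⊗ₜ[K] φ₀ t ∈ B := (Submodule.Quotient.mk_eq_zero B).1 ht
    have h0 : φ₀ t = 0 := eq_zero_of_totalD_eq_one_tmul hL hsq hc hd hdL
      (fun x hx ↦ map_eq_zero_of_signedMul b hmin hx) hp
    ext i
    have := DFunLike.congr_fun h0 i
    rw [hφ₀a, Finsupp.zero_apply, smul_eq_zero] at this
    exact this.resolve_right (ExteriorAlgebra.topElem_ne_zero b)
  have hrel : ∀ v i, (MvPolynomial.X v : S) • φ (Finsupp.single i 1) =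
      (s * (-1) ^ deg i) • φ (Finsupp.mapRange.linearMap (linCoeff b v)
        (d (Finsupp.single i 1))) := by
    intro v i
    have h1 : d (Finsupp.single i (contractLeft (b.coord v) (topElem b))) =
        (-s) • φ₀ (Finsupp.mapRange.linearMap (linCoeff b v) (d (Finsupp.single i 1))) := by
      ext j
      rw [linearMap_single, Finsupp.smul_apply, smul_eq_mul,
        contractLeft_topElem_mul b htop v (hmin i j), Finsupp.smul_apply, hφ₀a, smul_smul]
      rfl
    have h2 : ∀ w, L w (Finsupp.single i (contractLeft (b.coord v) (topElem b))) =
        if w = v then (-1 : K) ^ deg i • Finsupp.single i (topElem b) else 0 := by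
      classical
      intro w
      ext j
      rw [signedMul_apply, Finsupp.single_apply]
      split_ifs with h3 h4 h4
      · rw [ι_mul_contractLeft_topElem, if_pos h4, h3]
        simp
      · rw [ι_mul_contractLeft_topElem, if_neg h4, smul_zero, Finsupp.zero_apply]
      · simp [h3]
      · simp
    -- This boundary is zero in the quotient; it identifies the `X v`-multiple of the class of
    -- generator `i` with the class given by the linear coefficients of `d`, up to sign.
    have h3 : D (1 ⊗ₜ Finsupp.single i (contractLeft (b.coord v) (topElem b))) =
        (-s) • (1 : S) ⊗ₜ[K] φ₀ (Finsupp.mapRange.linearMap (linCoeff b v)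
          (d (Finsupp.single i 1))) +
        (-1 : K) ^ deg i • (MvPolynomial.X v : S) ⊗ₜ[K] Finsupp.single i (topElem b) := by
      rw [totalD_apply, LinearMap.baseChange_tmul, cartan_tmul]
      congr 1
      · rw [← TensorProduct.tmul_smul, ← h1]
        rfl
      · rw [Finset.sum_eq_single v]
        · rw [h2, if_pos rfl, mul_one, TensorProduct.tmul_smul]
        · intro w _ hw
          rw [h2, if_neg hw, TensorProduct.tmul_zero]
        · simp
    have h4 : B.mkQ (D (1 ⊗ₜ Finsupp.single i (contractLeft (b.coord v) (topElem b)))) = 0 :=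
      (Submodule.Quotient.mk_eq_zero B).2 ⟨_, rfl⟩
    rw [h3, map_add] at h4
    have h5 : (MvPolynomial.X v : S) • φ (Finsupp.single i 1) =
        B.mkQ ((MvPolynomial.X v : S) ⊗ₜ[K] Finsupp.single i (topElem b)) := by
      change (MvPolynomial.X v : S) • B.mkQ (1 ⊗ₜ φ₀ (Finsupp.single i 1)) = _
      rw [← map_smul, hφ₀, one_smul, TensorProduct.smul_tmul', smul_eq_mul, mul_one]
    rw [h5]
    have h6 : (-s) • φ (Finsupp.mapRange.linearMap (linCoeff b v) (d (Finsupp.single i 1))) +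
        (-1 : K) ^ deg i • B.mkQ ((MvPolynomial.X v : S) ⊗ₜ[K] Finsupp.single i (topElem b)) =
          0 := h4
    have h7 := eq_neg_of_add_eq_zero_right h6
    rw [neg_smul, neg_neg] at h7
    rw [mul_comm, mul_smul, ← h7, sign_smul_sign_smul]
  -- Socle elements are cycles of `D`, hence homologous to elements of `S ⊗ M`. This places their
  -- classes in a finitely generated `S`-module.
  have hsub : ∀ t, φ t ∈ (LinearMap.range (M.subtype.baseChange S)).map B.mkQ := by
    intro t
    have hcyc : D (1 ⊗ₜ φ₀ t) = 0 := by
      have h1 : ∀ v, L v (φ₀ t) = 0 := by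
        intro v
        ext i
        rw [signedMul_apply, hφ₀a, mul_smul_comm, ExteriorAlgebra.ι_mul_topElem, smul_zero,
          smul_zero, Finsupp.zero_apply]
      rw [totalD_apply, LinearMap.baseChange_tmul, cartan_tmul]
      rw [show d' (φ₀ t) = 0 from map_eq_zero_of_signedMul b hmin h1]
      simp [h1]
    obtain ⟨q, hq⟩ := exists_sub_totalD_mem (ρ := degProj K V deg) (M := M) hL hsq hd hdL
      (fun m n x ↦ by
        ext i
        simp only [degProj_apply]
        by_cases h1 : m = n
        · subst h1
          rw [if_pos rfl, degProj_apply]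
          split_ifs <;> rfl
        · rw [if_neg h1, Finsupp.zero_apply]
          split_ifs with h2 h3
          · exact absurd (h2.symm.trans h3) h1
          · rfl
          · rfl)
      (fun n x ↦ diagMap_comm hdeg (fun i j hij ↦ by simp [hij]) x)
      (degProj_signedMul b deg) (sum_degProj deg)
      (fun x hx ↦ hM _ (fun i ↦ deg_eq_of_degProj_ne_zero) hx)
      (fun n x hx ↦ hex n _ (fun i ↦ deg_eq_of_degProj_ne_zero) hx) hcyc
    refine ⟨_, hq, ?_⟩
    rw [map_sub]
    change _ - B.mkQ (D q) = _
    rw [show B.mkQ (D q) = 0 from (Submodule.Quotient.mk_eq_zero B).2 ⟨_, rfl⟩, sub_zero]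
    rfl
  -- By `hrel` the variables preserve the range of `φ`, so it is an `S`-submodule.
  have hsmul : ∀ (p : S) (t : I →₀ K), p • φ t ∈ LinearMap.range φ := by
    intro p
    induction p using MvPolynomial.induction_on with
    | C a =>
      intro t
      rw [← MvPolynomial.algebraMap_eq, algebraMap_smul, ← map_smul]
      exact ⟨_, rfl⟩
    | add p q hp hq =>
      intro t
      rw [add_smul]
      exact add_mem (hp t) (hq t)
    | mul_X p v hp =>
      intro t
      rw [mul_smul]
      suffices h : (MvPolynomial.X v : S) • φ t ∈ LinearMap.range φ by
        obtain ⟨t', ht'⟩ := h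
        rw [← ht']
        exact hp t'
      induction t using Finsupp.induction_linear with
      | zero => simp
      | add x y hx hy =>
        rw [map_add, smul_add]
        exact add_mem hx hy
      | single i a =>
        rw [show Finsupp.single i a = a • Finsupp.single i (1 : K) by simp, map_smul,
          smul_comm, hrel, ← map_smul, ← map_smul]
        exact ⟨_, rfl⟩
  let R : Submodule S ((S ⊗[K] N) ⧸ B) :=
    { carrier := LinearMap.range φ
      add_mem' := fun ha hb ↦ add_mem ha hb
      zero_mem' := zero_mem _
      smul_mem' := by
        rintro p _ ⟨t, rfl⟩
        exact hsmul p t }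
  have hR : IsNoetherian S R := by
    have : IsNoetherian S (S ⊗[K] M) := isNoetherian_of_isNoetherianRing_of_finite S _
    have h1 : IsNoetherian S ((LinearMap.range (M.subtype.baseChange S)).map B.mkQ) := by
      rw [← LinearMap.range_comp]
      infer_instance
    refine isNoetherian_of_le (t := (LinearMap.range (M.subtype.baseChange S)).map B.mkQ) ?_
    rintro _ ⟨t, rfl⟩
    exact hsub t
  let φ' : (I →₀ K) →ₗ[K] R :=
    { toFun := fun t ↦ ⟨φ t, t, rfl⟩
      map_add' := fun x y ↦ Subtype.ext (map_add φ x y)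
      map_smul' := fun a x ↦ Subtype.ext (map_smul φ a x) }
  have hφ' : Function.Bijective φ' := by
    refine ⟨fun x y hxy ↦ hφinj (congrArg Subtype.val hxy), ?_⟩
    rintro ⟨_, t, rfl⟩
    exact ⟨t, rfl⟩
  exact ⟨R, inferInstance, inferInstance, inferInstance, inferInstance, hR,
    LinearEquiv.ofBijective φ' hφ', s, fun v i ↦ Subtype.ext (hrel v i)⟩

end LinearPartExact

/-! ### The linear part as a Koszul-type complex. -/

section LinearPartExact

open TensorProduct
open CliffordAlgebra (involute contractLeft contractRight)
open ExteriorAlgebra (ι linCoeff topElem)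

variable {K : Type u} [Field K] {V : Type v} [AddCommGroup V] [Module K V] {I : Type w}

theorem linStd_single_apply (d : (I →₀ ExteriorAlgebra K V) →ₗ[ExteriorAlgebra K V]
    (I →₀ ExteriorAlgebra K V)) (i j : I) :
    linStd d (Finsupp.single i 1) j = linElem (d (Finsupp.single i 1) j) := by
  rw [linStd_single]
  rfl

/-- The linear part of a minimal complex of free modules that is exact in positive degrees, with
finite-dimensional cycles in degree zero, is exact in large degrees. -/
theorem exists_linStd_exact [FiniteDimensional K V] {deg : I → ℕ}
    {d : (I →₀ ExteriorAlgebra K V) →ₗ[ExteriorAlgebra K V] (I →₀ ExteriorAlgebra K V)}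
    (hdeg : ∀ i j, d (Finsupp.single i 1) j ≠ 0 → deg j = deg i + 1)
    (hmin : ∀ i j, d (Finsupp.single i 1) j ∈ maxIdeal K V) (hd : ∀ x, d (d x) = 0)
    (M : Submodule K (I →₀ ExteriorAlgebra K V)) [FiniteDimensional K M]
    (hM : ∀ x, (∀ i, x i ≠ 0 → deg i = 0) → d x = 0 → x ∈ M)
    (hex : ∀ n x, (∀ i, x i ≠ 0 → deg i = n + 1) → d x = 0 → ∃ y, d y = x) :
    ∃ N, ∀ n ≥ N, ∀ x, (∀ i, x i ≠ 0 → deg i = n + 1) → linStd d x = 0 →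
      ∃ y, (∀ i, y i ≠ 0 → deg i = n) ∧ linStd d y = x := by
  let σ := Module.Free.ChooseBasisIndex K V
  let b : Module.Basis σ K V := Module.Free.chooseBasis K V
  classical
  obtain ⟨Q, _, _, _, _, _, φ, s, hφ⟩ := exists_noetherian_model b hdeg hmin hd M hM hex
  let S := MvPolynomial σ K
  let E := ExteriorAlgebra K V
  let R : σ → E →ₗ[K] E := fun v ↦ LinearMap.mulRight K (ι K (b v))
  let κ : Q ⊗[K] E →ₗ[S] Q ⊗[K] E :=
    ∑ v, (MvPolynomial.X v : S) • AlgebraTensorModule.lTensor S Q (R v)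
  have hκ : ∀ q a, κ (q ⊗ₜ a) = ∑ v, ((MvPolynomial.X v : S) • q) ⊗ₜ (a * ι K (b v)) := by
    intro q a
    simp [κ, LinearMap.sum_apply, TensorProduct.smul_tmul', R]
  have : IsNoetherian S (Q ⊗[K] E) := by
    have h1 : Module.Finite S (Q ⊗[S] (S ⊗[K] E)) := inferInstance
    have h2 : Module.Finite S (Q ⊗[K] E) :=
      Module.Finite.equiv (AlgebraTensorModule.cancelBaseChange K S S Q E)
    exact isNoetherian_of_isNoetherianRing_of_finite S _
  have hkos : ∀ v z, κ z = 0 → ∃ w, κ w = (MvPolynomial.X v : S) • z := by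
    intro v z hz
    -- Right contraction along `v` is a homotopy between multiplication by `X v` and zero.
    let c : Q ⊗[K] E →ₗ[K] Q ⊗[K] E :=
      LinearMap.lTensor Q ((contractRight (Q := (0 : QuadraticForm K V))).flip (b.coord v))
    have hc : ∀ z, κ (c z) + c (κ z) = (MvPolynomial.X v : S) • z := by
      intro z
      induction z with
      | zero => simp
      | add p q hp hq =>
        rw [map_add, map_add, map_add, map_add, smul_add, ← hp, ← hq]
        abel
      | tmul q a =>
        rw [hκ, map_sum]
        simp only [c, LinearMap.lTensor_tmul, LinearMap.flip_apply]
        rw [hκ, ← Finset.sum_add_distrib, Finset.sum_eq_single v]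
        · rw [← TensorProduct.tmul_add,
            show contractRight (a * ι K (b v)) (b.coord v) = _ from
              CliffordAlgebra.contractRight_mul_ι (b.coord v) (b v) a]
          rw [b.coord_apply, b.repr_self, Finsupp.single_eq_same, one_smul,
            TensorProduct.smul_tmul']
          congr 1
          exact add_sub_cancel _ _
        · intro w _ hw
          rw [← TensorProduct.tmul_add,
            show contractRight (a * ι K (b w)) (b.coord v) = _ from
              CliffordAlgebra.contractRight_mul_ι (b.coord v) (b w) a]
          rw [b.coord_apply, b.repr_self, Finsupp.single_apply, if_neg hw, zero_smul]
          rw [show contractRight a (b.coord v) * ι K (b w) +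
            (0 - contractRight a (b.coord v) * ι K (b w)) = 0 by abel, TensorProduct.tmul_zero]
        · simp
    exact ⟨c z, by rw [← hc, hz, map_zero, add_zero]⟩
  obtain ⟨Y, hY⟩ := exists_finset_cycles κ hkos
  -- transport to the linear part
  let Ψ : (I →₀ E) ≃ₗ[K] Q ⊗[K] E :=
    (TensorProduct.finsuppScalarLeft K E I).symm ≪≫ₗ TensorProduct.congr φ (LinearEquiv.refl K E)
  have hΨ : ∀ i a, Ψ (Finsupp.single i a) = φ (Finsupp.single i 1) ⊗ₜ a := by
    intro i a
    simp [Ψ]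
  have hlin : ∀ i a, Ψ (linStd d (Finsupp.single i a)) =
      ∑ v, φ (Finsupp.mapRange.linearMap (linCoeff b v) (d (Finsupp.single i 1))) ⊗ₜ
        (a * ι K (b v)) := by
    intro i a
    let F : E →ₗ[K] E := ∑ v, (LinearMap.toSpanSingleton K E (a * ι K (b v))) ∘ₗ linCoeff b v
    have h1 : linStd d (Finsupp.single i a) =
        Finsupp.mapRange.linearMap F (d (Finsupp.single i 1)) := by
      ext j
      rw [linearMap_single, Finsupp.smul_apply, linStd_single_apply,
        ExteriorAlgebra.linElem_eq_sum_linCoeff b (hmin i j), smul_eq_mul, Finset.mul_sum]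
      change _ = F _
      simp only [F, LinearMap.sum_apply, LinearMap.comp_apply, LinearMap.toSpanSingleton_apply,
        mul_smul_comm]
    rw [h1]
    generalize d (Finsupp.single i 1) = y
    induction y using Finsupp.induction_linear with
    | zero => simp
    | add x y hx hy => simp only [map_add, hx, hy, TensorProduct.add_tmul, Finset.sum_add_distrib]
    | single j c =>
      rw [Finsupp.mapRange.linearMap_apply, Finsupp.mapRange_single, hΨ]
      simp only [F, LinearMap.sum_apply, LinearMap.comp_apply, LinearMap.toSpanSingleton_apply,
        TensorProduct.tmul_sum]
      refine Finset.sum_congr rfl fun v _ ↦ ?_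
      rw [Finsupp.mapRange.linearMap_apply, Finsupp.mapRange_single, TensorProduct.tmul_smul,
        TensorProduct.smul_tmul', ← map_smul, Finsupp.smul_single, smul_eq_mul, mul_one]
  -- Absorbs the sign `(-1) ^ deg i` in the action of the variables on `Q`.
  let ε : Module.End K (I →₀ E) := diagMap V fun i ↦ (-1) ^ deg i
  have hεε : ∀ x, ε (ε x) = x := fun x ↦ by
    ext i
    rw [diagMap_apply, diagMap_apply, sign_smul_sign_smul]
  have hκΨ : ∀ x, κ (Ψ x) = s • Ψ (linStd d (ε x)) := by
    intro x
    induction x using Finsupp.induction_linear with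
    | zero => simp
    | add x y hx hy => simp only [map_add, hx, hy, smul_add]
    | single i a =>
      rw [hΨ, hκ, diagMap_single, ← LinearMap.coe_restrictScalars K (linStd d), map_smul,
        LinearMap.coe_restrictScalars, map_smul, hlin, smul_smul, Finset.smul_sum]
      refine Finset.sum_congr rfl fun v _ ↦ ?_
      rw [hφ, TensorProduct.smul_tmul']
  have hlindeg : ∀ i j, linStd d (Finsupp.single i 1) j ≠ 0 → deg j = deg i + 1 := by
    intro i j h
    refine hdeg i j fun h' ↦ h ?_
    rw [linStd_single_apply, h', map_zero]
  -- Finitely many representatives span the homology, and together they involve only finitely many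
  -- degrees.
  have hbound : ∃ N, ∀ y ∈ Submodule.span K (Y : Set (Q ⊗[K] E)), ∀ n ≥ N,
      degProj K V deg n (Ψ.symm y) = 0 := by
    choose J hJ using fun y ↦ degProj_eventually_zero deg (Ψ.symm y)
    refine ⟨Y.sup J, fun y hy n hn ↦ ?_⟩
    induction hy using Submodule.span_induction with
    | mem y hy => exact hJ y n (le_trans (Finset.le_sup hy) hn)
    | zero => simp
    | add x y _ _ hx hy => rw [map_add, map_add, hx, hy, add_zero]
    | smul a x _ hx => rw [map_smul, map_smul, hx, smul_zero]
  obtain ⟨N, hN⟩ := hbound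
  refine ⟨N, fun n hn x hx hxlin ↦ ?_⟩
  have hεx : ε x = (-1 : K) ^ (n + 1) • x := by
    ext i
    rw [diagMap_apply, Finsupp.smul_apply]
    by_cases h : x i = 0
    · rw [h, smul_zero, smul_zero]
    · rw [hx i h]
  obtain ⟨y, hy, w, hw⟩ := hY (Ψ x) (by
    rw [hκΨ, hεx, ← LinearMap.coe_restrictScalars K (linStd d), map_smul,
      LinearMap.coe_restrictScalars, hxlin, smul_zero, map_zero, smul_zero])
  have h1 : x = Ψ.symm y + s • linStd d (ε (Ψ.symm w)) := by
    rw [← Ψ.symm_apply_apply x, hw, map_add]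
    congr 1
    rw [← Ψ.apply_symm_apply w, hκΨ, map_smul, Ψ.symm_apply_apply, Ψ.symm_apply_apply]
  -- In degree `n + 1` the representative `y` contributes nothing, so the component of degree `n` of
  -- the other summand is a primitive.
  refine ⟨s • degProj K V deg n (ε (Ψ.symm w)), fun i hi ↦ ?_, ?_⟩
  · refine deg_eq_of_degProj_ne_zero (x := ε (Ψ.symm w)) fun h ↦ hi ?_
    rw [Finsupp.smul_apply, h, smul_zero]
  · rw [← LinearMap.coe_restrictScalars K (linStd d), map_smul, LinearMap.coe_restrictScalars]
    have h2 := diagMap_comm hlindeg (g := fun i ↦ if deg i = n + 1 then (1 : K) else 0)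
      (h := fun i ↦ if deg i = n then (1 : K) else 0) (fun i j hij ↦ by simp [hij])
      (ε (Ψ.symm w))
    have h3 := congrArg (degProj K V deg (n + 1)) h1
    rw [degProj_eq_self hx, map_add, hN y hy (n + 1) (by omega), zero_add, map_smul] at h3
    rw [h3]
    exact congrArg (s • ·) h2.symm

end LinearPartExact

/-! ### From a sequence of free modules to their direct sum. -/

section Sequence

variable {K : Type u} [Field K] {V : Type v} [AddCommGroup V] [Module K V]
  {X : ℕ → Type*} [∀ n, AddCommGroup (X n)] [∀ n, Module (ExteriorAlgebra K V) (X n)]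
  {ι : ℕ → Type*} (b : ∀ n, Module.Basis (ι n) (ExteriorAlgebra K V) (X n))

/-- The inclusion of a term of a sequence of free modules into the sum of all terms. -/
noncomputable def inclTotal (n : ℕ) :
    X n →ₗ[ExteriorAlgebra K V] ((Σ n, ι n) →₀ ExteriorAlgebra K V) :=
  Finsupp.lmapDomain _ _ (Sigma.mk n) ∘ₗ (b n).repr.toLinearMap

theorem inclTotal_injective (n : ℕ) : Function.Injective (inclTotal b n) :=
  (Finsupp.mapDomain_injective sigma_mk_injective).comp (b n).repr.injective

theorem inclTotal_basis (n : ℕ) (i : ι n) : inclTotal b n (b n i) = Finsupp.single ⟨n, i⟩ 1 := by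
  simp [inclTotal]

theorem inclTotal_apply_mk (n : ℕ) (x : X n) (i : ι n) :
    inclTotal b n x ⟨n, i⟩ = (b n).repr x i :=
  Finsupp.mapDomain_apply sigma_mk_injective _ _

theorem fst_eq_of_inclTotal_ne_zero {n : ℕ} {x : X n} {j : Σ n, ι n} (h : inclTotal b n x j ≠ 0) :
    j.1 = n := by
  by_contra h'
  refine h (Finsupp.mapDomain_of_notMem_range _ _ ?_)
  rintro ⟨i, rfl⟩
  exact h' rfl

theorem exists_inclTotal_eq {n : ℕ} {x : (Σ n, ι n) →₀ ExteriorAlgebra K V}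
    (hx : ∀ j, x j ≠ 0 → j.1 = n) : ∃ y, inclTotal b n y = x := by
  refine ⟨(b n).repr.symm (x.comapDomain (Sigma.mk n) sigma_mk_injective.injOn), ?_⟩
  rw [inclTotal, LinearMap.comp_apply, LinearEquiv.coe_coe, LinearEquiv.apply_symm_apply]
  refine Finsupp.mapDomain_comapDomain _ sigma_mk_injective _ ?_
  rintro ⟨m, i⟩ hi
  obtain rfl : m = n := hx _ (Finsupp.mem_support_iff.1 hi)
  exact ⟨i, rfl⟩

variable (d : ∀ n, X n →ₗ[ExteriorAlgebra K V] X (n + 1))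

/-- The differential on the sum of all terms of a sequence of free modules. -/
noncomputable def totalMap : ((Σ n, ι n) →₀ ExteriorAlgebra K V) →ₗ[ExteriorAlgebra K V]
    ((Σ n, ι n) →₀ ExteriorAlgebra K V) :=
  Finsupp.linearCombination _ fun p ↦ inclTotal b (p.1 + 1) (d p.1 (b p.1 p.2))

theorem totalMap_single (p : Σ n, ι n) :
    totalMap b d (Finsupp.single p 1) = inclTotal b (p.1 + 1) (d p.1 (b p.1 p.2)) := by
  simp [totalMap]

theorem totalMap_inclTotal (n : ℕ) (x : X n) :
    totalMap b d (inclTotal b n x) = inclTotal b (n + 1) (d n x) := by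
  rw [← LinearMap.comp_apply, ← LinearMap.comp_apply]
  congr 1
  refine (b n).ext fun i ↦ ?_
  rw [LinearMap.comp_apply, inclTotal_basis, totalMap_single, LinearMap.comp_apply]

theorem linStd_totalMap_inclTotal (n : ℕ) (x : X n) :
    linStd (totalMap b d) (inclTotal b n x) =
      inclTotal b (n + 1) (linMap (b n) (b (n + 1)) (d n) x) := by
  rw [← LinearMap.comp_apply, ← LinearMap.comp_apply]
  congr 1
  refine (b n).ext fun i ↦ ?_
  rw [LinearMap.comp_apply, inclTotal_basis, LinearMap.comp_apply, linMap,
    Module.Basis.constr_basis, inclTotal, LinearMap.comp_apply, LinearEquiv.coe_coe,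
    LinearEquiv.apply_symm_apply, linStd_single, totalMap_single]
  exact (Finsupp.mapDomain_mapRange _ _ _ (map_zero linElem) (map_add linElem)).symm

/-- The linear part of a minimal cochain complex of free modules that is exact in positive
degrees, with finitely generated cycles in degree zero, is exact in large degrees. -/
theorem exists_linMap_exact [FiniteDimensional K V] (hmin : ∀ n, IsMinimalMap (d n))
    (hd : ∀ n x, d (n + 1) (d n x) = 0) (hex : ∀ n x, d (n + 1) x = 0 → ∃ y, d n y = x)
    (hfin : (LinearMap.ker (d 0)).FG) :
    ∃ N, ∀ n ≥ N, Function.Exact (linMap (b n) (b (n + 1)) (d n))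
      (linMap (b (n + 1)) (b (n + 2)) (d (n + 1))) := by
  -- The degree-zero cycles inside the sum; being finitely generated over the finite-dimensional
  -- `E`, they are finite-dimensional.
  let M : Submodule K ((Σ n, ι n) →₀ ExteriorAlgebra K V) :=
    ((LinearMap.ker (d 0)).map (inclTotal b 0)).restrictScalars K
  have : FiniteDimensional K M := by
    have h1 : Module.Finite (ExteriorAlgebra K V) ((LinearMap.ker (d 0)).map (inclTotal b 0)) :=
      Module.Finite.iff_fg.2 (hfin.map _)
    have h2 : IsScalarTower K (ExteriorAlgebra K V)
        ((LinearMap.ker (d 0)).map (inclTotal b 0)) :=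
      ⟨fun k a x ↦ Subtype.ext (smul_assoc k a x.1)⟩
    have h3 : Module.Finite K ((LinearMap.ker (d 0)).map (inclTotal b 0)) :=
      Module.Finite.trans (ExteriorAlgebra K V) _
    exact h3
  obtain ⟨N, hN⟩ := exists_linStd_exact (deg := Sigma.fst) (d := totalMap b d)
    (fun i j hj ↦ by
      rw [totalMap_single] at hj
      exact fst_eq_of_inclTotal_ne_zero b hj)
    (fun i j ↦ by
      rw [totalMap_single]
      by_cases hj : inclTotal b (i.1 + 1) (d i.1 (b i.1 i.2)) j = 0
      · rw [hj]
        exact zero_mem _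
      · obtain ⟨m, k⟩ := j
        obtain rfl : m = i.1 + 1 := fst_eq_of_inclTotal_ne_zero b hj
        rw [inclTotal_apply_mk]
        exact repr_mem_maxIdeal _ (hmin _ ⟨_, rfl⟩) _)
    (LinearMap.congr_fun (f := totalMap b d ∘ₗ totalMap b d) (g := 0)
      (Finsupp.basisSingleOne.ext fun i ↦ by
        change totalMap b d (totalMap b d (Finsupp.single i 1)) = 0
        rw [totalMap_single, totalMap_inclTotal, hd, map_zero]))
    M
    (fun x hx hdx ↦ by
      obtain ⟨y, rfl⟩ := exists_inclTotal_eq b hx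
      rw [totalMap_inclTotal] at hdx
      exact ⟨y, inclTotal_injective b _ (hdx.trans (map_zero _).symm), rfl⟩)
    (fun n x hx hdx ↦ by
      obtain ⟨y, rfl⟩ := exists_inclTotal_eq b hx
      rw [totalMap_inclTotal] at hdx
      obtain ⟨z, rfl⟩ := hex n y (inclTotal_injective b _ (hdx.trans (map_zero _).symm))
      exact ⟨inclTotal b n z, totalMap_inclTotal b d n z⟩)
  refine ⟨N, fun n hn y ↦ ⟨fun hy ↦ ?_, ?_⟩⟩
  · obtain ⟨z, hz, hzy⟩ := hN n hn (inclTotal b (n + 1) y)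
      (fun j hj ↦ fst_eq_of_inclTotal_ne_zero b hj)
      (by rw [linStd_totalMap_inclTotal, hy, map_zero])
    obtain ⟨x, rfl⟩ := exists_inclTotal_eq b hz
    rw [linStd_totalMap_inclTotal] at hzy
    exact ⟨x, inclTotal_injective b _ hzy⟩
  · rintro ⟨x, rfl⟩
    exact LinearMap.congr_fun (linMap_comp_linMap (b n) (b (n + 1)) (b (n + 2)) (hmin n)
      (hmin (n + 1)) (LinearMap.ext (hd n))) x

end Sequence

/-! ### Minimal free covers, self-injectivity and minimal embeddings. -/

section CoversAndHulls

open ExteriorAlgebra (ι topElem algebraMapInv)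

variable {K : Type u} [Field K] {V : Type v} [AddCommGroup V] [Module K V]

theorem mem_maxIdeal_smul_top_iff {N κ : Type*} [AddCommGroup N]
    [Module (ExteriorAlgebra K V) N] (c : Module.Basis κ (ExteriorAlgebra K V) N) {x : N} :
    x ∈ maxIdeal K V • (⊤ : Submodule (ExteriorAlgebra K V) N) ↔
      ∀ k, c.repr x k ∈ maxIdeal K V := by
  refine ⟨fun hx ↦ repr_mem_maxIdeal c hx, fun h ↦ ?_⟩
  rw [← c.linearCombination_repr x, Finsupp.linearCombination_apply]
  exact Submodule.sum_mem _ fun k _ ↦ Submodule.smul_mem_smul (h k) trivial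

theorem eq_smul_topElem_of_maxIdeal {σ : Type*} [Fintype σ] (b : Module.Basis σ K V)
    {x : ExteriorAlgebra K V} (hx : ∀ a ∈ maxIdeal K V, a * x = 0) : ∃ k : K, x = k • topElem b :=
  ExteriorAlgebra.exists_eq_smul_topElem b fun v ↦ hx _ (by
    simpa using ExteriorAlgebra.ι_mul_mem_maxIdeal (b v) 1)

variable [FiniteDimensional K V]

theorem mul_mem_maxIdeal {a : ExteriorAlgebra K V} (ha : a ∈ maxIdeal K V)
    (c : ExteriorAlgebra K V) : a * c ∈ maxIdeal K V := by
  rw [ExteriorAlgebra.mem_maxIdeal_iff] at ha ⊢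
  rw [map_mul, ha, zero_mul]

/-- Every finitely generated module over the exterior algebra has a minimal free cover. -/
theorem exists_minimal_cover (M : Type*) [AddCommGroup M] [Module (ExteriorAlgebra K V) M]
    [Module.Finite (ExteriorAlgebra K V) M] :
    ∃ (n : ℕ) (π : (Fin n →₀ ExteriorAlgebra K V) →ₗ[ExteriorAlgebra K V] M),
      Function.Surjective π ∧ LinearMap.ker π ≤ maxIdeal K V • ⊤ := by
  classical
  let P : ℕ → Prop := fun n ↦ ∃ s : Finset M, s.card = n ∧
    Submodule.span (ExteriorAlgebra K V) (s : Set M) = ⊤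
  have hP : ∃ n, P n := by
    obtain ⟨s, hs⟩ := Module.Finite.fg_top (R := ExteriorAlgebra K V) (M := M)
    exact ⟨_, s, rfl, hs⟩
  obtain ⟨s, hsn, hs⟩ := Nat.find_spec hP
  have hmin : ∀ t : Finset M, Submodule.span (ExteriorAlgebra K V) (t : Set M) = ⊤ →
      s.card ≤ t.card := fun t ht ↦ hsn ▸ Nat.find_min' hP ⟨t, rfl, ht⟩
  let e := s.equivFin.symm
  let f : Fin s.card → M := fun i ↦ e i
  have hrange : Set.range f = s := by
    ext x
    refine ⟨fun ⟨i, hi⟩ ↦ hi ▸ (e i).2, fun hx ↦ ⟨e.symm ⟨x, hx⟩, by simp [f]⟩⟩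
  refine ⟨s.card, Finsupp.linearCombination _ f, ?_, fun x hx ↦ ?_⟩
  · rw [← LinearMap.range_eq_top, Finsupp.range_linearCombination, hrange, hs]
  · rw [mem_maxIdeal_smul_top_iff Finsupp.basisSingleOne]
    intro j
    -- A coefficient outside the maximal ideal is a unit, so the relation would make one generator
    -- redundant, against the minimal cardinality of `s`.
    by_contra hj
    obtain ⟨c, hc⟩ := ExteriorAlgebra.isUnit_of_notMem_maxIdeal hj
    have hlt : (s.erase (f j)).card < s.card := Finset.card_erase_lt_of_mem (e j).2
    refine absurd (hmin (s.erase (f j)) ?_) (not_le.2 hlt)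
    have hmem : ∀ i, i ≠ j → f i ∈ Submodule.span (ExteriorAlgebra K V)
        ((s.erase (f j) : Finset M) : Set M) := by
      intro i hi
      refine Submodule.subset_span (Finset.mem_coe.2 (Finset.mem_erase.2 ⟨fun h ↦ hi ?_, (e i).2⟩))
      exact e.injective (Subtype.ext h)
    have hxj : f j ∈ Submodule.span (ExteriorAlgebra K V)
        ((s.erase (f j) : Finset M) : Set M) := by
      have h0 : Finsupp.linearCombination (ExteriorAlgebra K V) f x = 0 := hx
      rw [Finsupp.linearCombination_apply,
        Finsupp.sum_fintype x (fun i a ↦ a • f i) (fun i ↦ zero_smul _ _)] at h0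
      rw [← Finset.add_sum_erase _ _ (Finset.mem_univ j)] at h0
      have h1 : (↑c : ExteriorAlgebra K V) • f j =
          - ∑ i ∈ Finset.univ.erase j, x i • f i := by
        rw [hc]
        exact eq_neg_of_add_eq_zero_left h0
      have h2 : f j = (↑c⁻¹ : ExteriorAlgebra K V) • -∑ i ∈ Finset.univ.erase j, x i • f i := by
        rw [← h1, smul_smul, Units.inv_mul, one_smul]
      have h3 : (↑c⁻¹ : ExteriorAlgebra K V) • -∑ i ∈ Finset.univ.erase j, x i • f i ∈
          Submodule.span (ExteriorAlgebra K V) ((s.erase (f j) : Finset M) : Set M) :=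
        Submodule.smul_mem _ _ (Submodule.neg_mem _ (Submodule.sum_mem _ fun i hi ↦
          Submodule.smul_mem _ _ (hmem i (Finset.ne_of_mem_erase hi))))
      rwa [← h2] at h3
    rw [eq_top_iff, ← hs, Submodule.span_le, ← hrange]
    rintro _ ⟨i, rfl⟩
    by_cases hi : i = j
    · rw [hi]
      exact hxj
    · exact hmem i hi

/-- The functional `f ∘ g` on `J` extends linearly to all of `E`, where every functional has the
form `x ↦ f (x * y)`. Nondegeneracy then forces `g x = x * y` on `J`. -/
theorem baer_exteriorAlgebra : Module.Baer (ExteriorAlgebra K V) (ExteriorAlgebra K V) := by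
  intro J g
  obtain ⟨f, hf⟩ := ExteriorAlgebra.exists_functional K V
  let β : ExteriorAlgebra K V →ₗ[K] Module.Dual K (ExteriorAlgebra K V) :=
    LinearMap.mk₂ K (fun y x ↦ f (x * y)) (by intros; simp [mul_add]) (by intros; simp)
      (by intros; simp [add_mul]) (by intros; simp)
  have hβ : Function.Injective β := by
    rw [← LinearMap.ker_eq_bot, LinearMap.ker_eq_bot']
    exact fun y hy ↦ hf y fun a ↦ LinearMap.congr_fun hy a
  have hβs : Function.Surjective β :=
    (LinearMap.injective_iff_surjective_of_finrank_eq_finrank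
      Subspace.dual_finrank_eq.symm).1 hβ
  obtain ⟨h, hh⟩ := LinearMap.exists_extend (p := J.restrictScalars K) (f ∘ₗ g.restrictScalars K)
  obtain ⟨y, hy⟩ := hβs h
  refine ⟨LinearMap.toSpanSingleton _ _ y, fun x hx ↦ ?_⟩
  rw [LinearMap.toSpanSingleton_apply, smul_eq_mul, ← sub_eq_zero]
  refine hf _ fun a ↦ ?_
  rw [mul_sub, map_sub, sub_eq_zero, ← mul_assoc]
  have h1 : f (a * x * y) = h (a * x) := LinearMap.congr_fun hy (a * x)
  have h2 : h (a * x) = f (g ⟨a * x, J.mul_mem_left a hx⟩) :=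
    LinearMap.congr_fun hh ⟨a * x, J.mul_mem_left a hx⟩
  rw [h1, h2, ← smul_eq_mul a (g _), ← map_smul]
  rfl

instance : Module.Injective (ExteriorAlgebra K V) (ExteriorAlgebra K V) :=
  baer_exteriorAlgebra.injective

instance (n : ℕ) : Module.Injective (ExteriorAlgebra K V) (Fin n →₀ ExteriorAlgebra K V) :=
  Module.Baer.injective (Module.Baer.of_equiv
    (Finsupp.linearEquivFunOnFinite _ _ _).symm (Module.Baer.of_injective
      (inferInstance : Module.Injective (ExteriorAlgebra K V) (Fin n → ExteriorAlgebra K V))))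

/-- The elements annihilated by the maximal ideal. -/
def socle (K : Type u) [Field K] (V : Type v) [AddCommGroup V] [Module K V]
    [FiniteDimensional K V] (M : Type*) [AddCommGroup M] [Module (ExteriorAlgebra K V) M] :
    Submodule (ExteriorAlgebra K V) M where
  carrier := {x | ∀ a ∈ maxIdeal K V, a • x = 0}
  add_mem' hx hy a ha := by rw [smul_add, hx a ha, hy a ha, add_zero]
  zero_mem' a _ := smul_zero a
  smul_mem' c x hx a ha := by rw [smul_smul, hx _ (mul_mem_maxIdeal ha c)]

theorem exists_smul_mem_socle {M : Type*} [AddCommGroup M] [Module (ExteriorAlgebra K V) M]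
    {x : M} (hx : x ≠ 0) : ∃ a : ExteriorAlgebra K V, a • x ≠ 0 ∧ a • x ∈ socle K V M := by
  let b := Module.Free.chooseBasis K V
  obtain ⟨a, ha, has⟩ := ExteriorAlgebra.exists_smul_ne_zero b hx
  refine ⟨a, ha, fun c hc ↦ ?_⟩
  have h1 : ∀ v, ∀ y : ExteriorAlgebra K V, (y * ι K (b v)) • a • x = 0 := fun v y ↦ by
    rw [mul_smul, has, smul_zero]
  obtain ⟨k, z, rfl⟩ := ExteriorAlgebra.exists_eq_sum_of_mem_maxIdeal b hc
  rw [add_smul, Finset.sum_smul, Finset.sum_smul, Finset.sum_eq_zero, zero_add,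
    Finset.sum_eq_zero]
  · intro v _
    rw [Finset.sum_smul]
    refine Finset.sum_eq_zero fun w _ ↦ ?_
    rw [ExteriorAlgebra.ι_mul_eq_involute_mul_ι, h1]
  · intro v _
    rw [Algebra.smul_def, h1]

/-- Every finitely generated module over the exterior algebra embeds into a free module of finite
rank whose socle lies in the image. -/
theorem exists_minimal_embedding (M : Type*) [AddCommGroup M] [Module (ExteriorAlgebra K V) M]
    [Module.Finite (ExteriorAlgebra K V) M] :
    ∃ (n : ℕ) (j : M →ₗ[ExteriorAlgebra K V] (Fin n →₀ ExteriorAlgebra K V)),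
      Function.Injective j ∧ socle K V (Fin n →₀ ExteriorAlgebra K V) ≤ LinearMap.range j := by
  let b := Module.Free.chooseBasis K V
  let _ : Module K M := Module.compHom M (algebraMap K (ExteriorAlgebra K V))
  have hsm : ∀ (k : K) (x : M), algebraMap K (ExteriorAlgebra K V) k • x = k • x := fun _ _ ↦ rfl
  have : IsScalarTower K (ExteriorAlgebra K V) M :=
    ⟨fun k a x ↦ by rw [← hsm, Algebra.smul_def, mul_smul]⟩
  have hfin : Module.Finite K M := Module.Finite.trans (ExteriorAlgebra K V) M
  have : Module.Finite K ((socle K V M).restrictScalars K) := inferInstance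
  let c := Module.finBasis K ((socle K V M).restrictScalars K)
  set n := Module.finrank K ((socle K V M).restrictScalars K)
  -- A `K`-basis of the socle of `M` is matched with the top elements of the free summands, which
  -- span the socle of the target.
  let f₀ : ((socle K V M).restrictScalars K) →ₗ[K] (Fin n →₀ ExteriorAlgebra K V) :=
    Finsupp.mapRange.linearMap (LinearMap.toSpanSingleton K _ (topElem b)) ∘ₗ c.repr.toLinearMap
  have hf₀ : ∀ x i, f₀ x i = c.repr x i • topElem b := fun x i ↦ rfl
  have htop : ∀ a : ExteriorAlgebra K V, a * topElem b = algebraMapInv a • topElem b := by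
    intro a
    obtain ⟨k, y, rfl⟩ := ExteriorAlgebra.exists_eq_algebraMap_add_sum b a
    rw [map_add, map_sum, Finset.sum_eq_zero fun v _ ↦ ExteriorAlgebra.algebraMapInv_ι_mul _ _,
      add_zero, ExteriorAlgebra.algebraMap_leftInverse V k, add_mul, Finset.sum_mul,
      Finset.sum_eq_zero, add_zero, ← Algebra.smul_def]
    intro v _
    rw [ExteriorAlgebra.ι_mul_eq_involute_mul_ι, mul_assoc, ExteriorAlgebra.ι_mul_topElem, mul_zero]
  have hsoc : ∀ (a : ExteriorAlgebra K V) (x : socle K V M), a • x = algebraMapInv a • x := by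
    intro a x
    refine Subtype.ext ?_
    have h1 : a - algebraMap K _ (algebraMapInv a) ∈ maxIdeal K V := by
      rw [ExteriorAlgebra.mem_maxIdeal_iff, map_sub,
        ExteriorAlgebra.algebraMap_leftInverse V, sub_self]
    have h2 := x.2 _ h1
    rw [sub_smul, sub_eq_zero] at h2
    exact h2
  let f : socle K V M →ₗ[ExteriorAlgebra K V] (Fin n →₀ ExteriorAlgebra K V) :=
    { toFun := f₀
      map_add' := map_add f₀
      map_smul' := fun a x ↦ by
        rw [hsoc]
        refine (map_smul f₀ _ x).trans ?_
        ext i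
        change algebraMapInv a • c.repr x i • topElem b = a * (c.repr x i • topElem b)
        rw [mul_smul_comm, htop, smul_comm] }
  have hfinj : Function.Injective f := by
    intro x y hxy
    refine c.repr.injective (Finsupp.ext fun i ↦ ?_)
    have h1 := DFunLike.congr_fun hxy i
    exact smul_left_injective K (ExteriorAlgebra.topElem_ne_zero b) h1
  -- Self-injectivity extends `f` to `M`. The extension is injective because every nonzero element
  -- has a nonzero multiple in the socle, where `f` is injective.
  obtain ⟨F, hF⟩ := Module.Baer.extension_property (Module.Baer.of_injective
    (inferInstance : Module.Injective (ExteriorAlgebra K V) (Fin n →₀ ExteriorAlgebra K V)))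
    (socle K V M).subtype (Submodule.subtype_injective _) f
  refine ⟨n, F, ?_, fun x hx ↦ ?_⟩
  · rw [← LinearMap.ker_eq_bot, LinearMap.ker_eq_bot']
    intro x hx
    by_contra hx0
    obtain ⟨a, ha, has⟩ := exists_smul_mem_socle (K := K) (V := V) hx0
    have h1 : f ⟨a • x, has⟩ = 0 := by
      rw [← hF, LinearMap.comp_apply, Submodule.subtype_apply, map_smul, hx, smul_zero]
    exact ha (congrArg Subtype.val (hfinj (h1.trans (map_zero f).symm)))
  · have h1 : ∀ i, ∃ k : K, x i = k • topElem b := fun i ↦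
      eq_smul_topElem_of_maxIdeal b fun a ha ↦ by
        rw [← smul_eq_mul, ← Finsupp.smul_apply, hx a ha, Finsupp.zero_apply]
    choose k hk using h1
    let y := c.repr.symm (Finsupp.equivFunOnFinite.symm k)
    refine ⟨(y : M), ?_⟩
    have h2 := LinearMap.congr_fun hF (show socle K V M from y)
    refine h2.trans (Finsupp.ext fun i ↦ ?_)
    rw [hk]
    change c.repr y i • topElem b = _
    simp [y]

end CoversAndHulls

/-! ### Resolutions from exact augmented complexes. -/

section OfExact

open Limits

variable {C : Type*} [Category C] [Abelian C] {Z : C}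

/-- A projective resolution from an exact augmented complex. -/
noncomputable def projectiveResolutionOfExact (A : ChainComplex C ℕ) (hA : ∀ n, Projective (A.X n))
    (p : A.X 0 ⟶ Z) (w : A.d 1 0 ≫ p = 0) (hp : Epi p) (h0 : (ShortComplex.mk _ _ w).Exact)
    (hex : ∀ n, A.ExactAt (n + 1)) : ProjectiveResolution Z where
  complex := A
  projective := hA
  π := (ChainComplex.toSingle₀Equiv _ _).symm ⟨p, w⟩
  quasiIso := ⟨fun n => by
    cases n
    · rw [ChainComplex.quasiIsoAt₀_iff, ShortComplex.quasiIso_iff_of_zeros']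
      · refine (ShortComplex.exact_and_epi_g_iff_of_iso ?_).2 ⟨h0, hp⟩
        exact ShortComplex.isoMk (Iso.refl _) (Iso.refl _) (Iso.refl _)
          ((Category.id_comp _).trans (Category.comp_id _).symm)
          ((Category.id_comp _).trans
            ((ChainComplex.toSingle₀Equiv_symm_apply_f_zero p w).symm.trans
              (Category.comp_id _).symm))
      all_goals first | rfl | exact A.shape _ _ (by simp)
    · rw [quasiIsoAt_iff_exactAt']
      · apply hex
      · apply ChainComplex.exactAt_succ_single_obj⟩

/-- An injective resolution from an exact coaugmented complex. -/
noncomputable def injectiveResolutionOfExact (A : CochainComplex C ℕ)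
    (hA : ∀ n, Injective (A.X n)) (i : Z ⟶ A.X 0) (w : i ≫ A.d 0 1 = 0) (hi : Mono i)
    (h0 : (ShortComplex.mk _ _ w).Exact) (hex : ∀ n, A.ExactAt (n + 1)) :
    InjectiveResolution Z where
  cocomplex := A
  injective := hA
  ι := (CochainComplex.fromSingle₀Equiv _ _).symm ⟨i, w⟩
  quasiIso := ⟨fun n => by
    cases n
    · rw [CochainComplex.quasiIsoAt₀_iff, ShortComplex.quasiIso_iff_of_zeros]
      · refine (ShortComplex.exact_and_mono_f_iff_of_iso ?_).2 ⟨h0, hi⟩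
        exact ShortComplex.isoMk (Iso.refl _) (Iso.refl _) (Iso.refl _)
          ((Category.id_comp _).trans
            ((CochainComplex.fromSingle₀Equiv_symm_apply_f_zero i w).symm.trans
              (Category.comp_id _).symm))
          ((Category.id_comp _).trans (Category.comp_id _).symm)
      all_goals first | rfl | exact A.shape _ _ (by simp)
    · rw [quasiIsoAt_iff_exactAt]
      · apply hex
      · apply CochainComplex.exactAt_succ_single_obj⟩

end OfExact

/-! ### Exactness at positive degrees in terms of linear maps. -/

section ExactAt

variable {R : Type u} [Ring R]

theorem ChainComplex.exactAt_succ_iff (A : ChainComplex (ModuleCat.{v} R) ℕ) (n : ℕ) :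
    A.ExactAt (n + 1) ↔ Function.Exact (A.d (n + 2) (n + 1)).hom (A.d (n + 1) n).hom := by
  rw [HomologicalComplex.exactAt_iff' _ (n + 2) (n + 1) n (by simp) (by simp),
    ShortComplex.moduleCat_exact_iff_range_eq_ker, LinearMap.exact_iff, eq_comm]
  rfl

theorem CochainComplex.exactAt_succ_iff (A : CochainComplex (ModuleCat.{v} R) ℕ) (n : ℕ) :
    A.ExactAt (n + 1) ↔ Function.Exact (A.d n (n + 1)).hom (A.d (n + 1) (n + 2)).hom := by
  rw [HomologicalComplex.exactAt_iff' _ n (n + 1) (n + 2) (by simp) (by simp),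
    ShortComplex.moduleCat_exact_iff_range_eq_ker, LinearMap.exact_iff, eq_comm]
  rfl

end ExactAt

/-! ### Construction of minimal free and injective resolutions. -/

section MinimalResolutions

open ExteriorAlgebra (ι topElem algebraMapInv)

variable {K : Type u} [Field K] {V : Type v} [AddCommGroup V] [Module K V]
  [FiniteDimensional K V]

instance : IsNoetherianRing (ExteriorAlgebra K V) :=
  isNoetherian_of_tower K inferInstance

variable (K V) in
/-- A free module of finite rank with a submodule. -/
abbrev FreeSubmodule : Type (max u v) :=
  Σ n : ℕ, Submodule (ExteriorAlgebra K V) (Fin n →₀ ExteriorAlgebra K V)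

section Cover

variable (M : Type*) [AddCommGroup M] [Module (ExteriorAlgebra K V) M]
  [Module.Finite (ExteriorAlgebra K V) M]

/-- The rank of a minimal free cover. -/
noncomputable def coverRank : ℕ := (exists_minimal_cover (K := K) (V := V) M).choose

/-- A minimal free cover. -/
noncomputable def coverMap : (Fin (coverRank (K := K) (V := V) M) →₀ ExteriorAlgebra K V)
    →ₗ[ExteriorAlgebra K V] M :=
  (exists_minimal_cover (K := K) (V := V) M).choose_spec.choose

theorem coverMap_surjective : Function.Surjective (coverMap (K := K) (V := V) M) :=
  (exists_minimal_cover (K := K) (V := V) M).choose_spec.choose_spec.1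

theorem ker_coverMap_le : LinearMap.ker (coverMap (K := K) (V := V) M) ≤ maxIdeal K V • ⊤ :=
  (exists_minimal_cover (K := K) (V := V) M).choose_spec.choose_spec.2

/-- The terms of the minimal free resolution together with the syzygies they contain. -/
noncomputable def syzygies : ℕ → FreeSubmodule K V
  | 0 => ⟨coverRank (K := K) (V := V) M, LinearMap.ker (coverMap M)⟩
  | n + 1 => ⟨coverRank (K := K) (V := V) (syzygies n).2, LinearMap.ker (coverMap (syzygies n).2)⟩

/-- The differential of the minimal free resolution. -/
noncomputable def syzygyMap (n : ℕ) : (Fin (syzygies (K := K) (V := V) M (n + 1)).1 →₀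
    ExteriorAlgebra K V) →ₗ[ExteriorAlgebra K V]
      (Fin (syzygies (K := K) (V := V) M n).1 →₀ ExteriorAlgebra K V) :=
  (syzygies M n).2.subtype ∘ₗ coverMap (syzygies M n).2

theorem range_syzygyMap (n : ℕ) :
    LinearMap.range (syzygyMap (K := K) (V := V) M n) = (syzygies M n).2 := by
  ext x
  refine ⟨?_, fun hx ↦ ?_⟩
  · rintro ⟨y, rfl⟩
    exact (coverMap (K := K) (V := V) (syzygies (K := K) (V := V) M n).2 y).2
  · obtain ⟨y, hy⟩ := coverMap_surjective (K := K) (V := V)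
      (syzygies (K := K) (V := V) M n).2 ⟨x, hx⟩
    exact ⟨y, congrArg Subtype.val hy⟩

theorem ker_syzygyMap (n : ℕ) :
    LinearMap.ker (syzygyMap (K := K) (V := V) M n) = (syzygies M (n + 1)).2 := by
  ext x
  exact ⟨fun hx ↦ Subtype.ext hx, fun hx ↦ congrArg Subtype.val hx⟩

theorem syzygies_le (n : ℕ) : (syzygies (K := K) (V := V) M n).2 ≤ maxIdeal K V • ⊤ := by
  cases n <;> exact ker_coverMap_le _

end Cover

/-- Every finitely generated module has a minimal free resolution by modules of finite rank. -/
theorem exists_minimal_projectiveResolution (M : ModuleCat.{max u v} (ExteriorAlgebra K V))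
    [Module.Finite (ExteriorAlgebra K V) M] :
    ∃ P : ProjectiveResolution M, IsMinimalFree P.complex ∧
      ∀ n, Module.Finite (ExteriorAlgebra K V) (P.complex.X n) := by
  let A : ChainComplex (ModuleCat.{max u v} (ExteriorAlgebra K V)) ℕ :=
    ChainComplex.of (fun n ↦ ModuleCat.of (ExteriorAlgebra K V)
      (Fin (syzygies (K := K) (V := V) M n).1 →₀ ExteriorAlgebra K V))
      (fun n ↦ ModuleCat.ofHom (syzygyMap M n)) (fun n ↦ by
        refine ModuleCat.hom_ext (LinearMap.range_le_ker_iff.1 ?_)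
        change LinearMap.range (syzygyMap M (n + 1)) ≤ LinearMap.ker (syzygyMap M n)
        rw [range_syzygyMap, ker_syzygyMap])
  have hA : ∀ n, A.d (n + 1) n = ModuleCat.ofHom (syzygyMap M n) := fun n ↦
    ChainComplex.of_d (fun n ↦ ModuleCat.of (ExteriorAlgebra K V)
      (Fin (syzygies (K := K) (V := V) M n).1 →₀ ExteriorAlgebra K V))
      (fun n ↦ ModuleCat.ofHom (syzygyMap M n)) n
  let p : A.X 0 ⟶ M := ModuleCat.ofHom (coverMap (K := K) (V := V) M)
  have w : A.d 1 0 ≫ p = 0 := by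
    rw [hA]
    refine ModuleCat.hom_ext (LinearMap.range_le_ker_iff.1 ?_)
    change LinearMap.range (syzygyMap M 0) ≤ LinearMap.ker (coverMap M)
    rw [range_syzygyMap]
    exact le_rfl
  refine ⟨projectiveResolutionOfExact A (fun n ↦ ?_) p w ?_ ?_ (fun n ↦ ?_), ⟨fun n ↦ ?_,
    fun i j ↦ ?_⟩, fun n ↦ ?_⟩
  · exact ModuleCat.projective_of_free (M := A.X n) Finsupp.basisSingleOne
  · exact (ModuleCat.epi_iff_surjective p).2 (coverMap_surjective _)
  · rw [ShortComplex.moduleCat_exact_iff_range_eq_ker]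
    change LinearMap.range (A.d 1 0).hom = LinearMap.ker (coverMap M)
    rw [hA, ModuleCat.hom_ofHom, range_syzygyMap]
    rfl
  · rw [ChainComplex.exactAt_succ_iff, hA, hA, LinearMap.exact_iff, ModuleCat.hom_ofHom,
      ModuleCat.hom_ofHom, range_syzygyMap, ker_syzygyMap]
  · exact inferInstanceAs (Module.Free (ExteriorAlgebra K V) (Fin _ →₀ ExteriorAlgebra K V))
  · change IsMinimalMap (A.d i j).hom
    by_cases hij : j + 1 = i
    · subst hij
      rw [hA, ModuleCat.hom_ofHom, IsMinimalMap, range_syzygyMap]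
      exact syzygies_le M j
    · rw [A.shape i j hij, IsMinimalMap, ModuleCat.hom_zero, LinearMap.range_zero]
      exact bot_le
  · exact inferInstanceAs (Module.Finite (ExteriorAlgebra K V) (Fin _ →₀ ExteriorAlgebra K V))

section Hull

variable (M : Type*) [AddCommGroup M] [Module (ExteriorAlgebra K V) M]
  [Module.Finite (ExteriorAlgebra K V) M]

/-- The rank of an injective hull. -/
noncomputable def hullRank : ℕ := (exists_minimal_embedding (K := K) (V := V) M).choose

/-- An injective hull. -/
noncomputable def hullMap : M →ₗ[ExteriorAlgebra K V]
    (Fin (hullRank (K := K) (V := V) M) →₀ ExteriorAlgebra K V) :=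
  (exists_minimal_embedding (K := K) (V := V) M).choose_spec.choose

theorem hullMap_injective : Function.Injective (hullMap (K := K) (V := V) M) :=
  (exists_minimal_embedding (K := K) (V := V) M).choose_spec.choose_spec.1

theorem socle_le_range_hullMap :
    socle K V _ ≤ LinearMap.range (hullMap (K := K) (V := V) M) :=
  (exists_minimal_embedding (K := K) (V := V) M).choose_spec.choose_spec.2

/-- The terms of the minimal injective resolution together with the cosyzygies they contain. -/
noncomputable def cosyzygies : ℕ → FreeSubmodule K V
  | 0 => ⟨hullRank (K := K) (V := V) M, LinearMap.range (hullMap M)⟩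
  | n + 1 => ⟨hullRank (K := K) (V := V) (_ ⧸ (cosyzygies n).2),
      LinearMap.range (hullMap (_ ⧸ (cosyzygies n).2))⟩

/-- The differential of the minimal injective resolution. -/
noncomputable def cosyzygyMap (n : ℕ) : (Fin (cosyzygies (K := K) (V := V) M n).1 →₀
    ExteriorAlgebra K V) →ₗ[ExteriorAlgebra K V]
      (Fin (cosyzygies (K := K) (V := V) M (n + 1)).1 →₀ ExteriorAlgebra K V) :=
  hullMap (_ ⧸ (cosyzygies M n).2) ∘ₗ (cosyzygies M n).2.mkQ

theorem range_cosyzygyMap (n : ℕ) :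
    LinearMap.range (cosyzygyMap (K := K) (V := V) M n) = (cosyzygies M (n + 1)).2 := by
  ext x
  refine ⟨?_, ?_⟩
  · rintro ⟨y, rfl⟩
    exact ⟨_, rfl⟩
  · rintro ⟨y, rfl⟩
    obtain ⟨z, rfl⟩ := (cosyzygies M n).2.mkQ_surjective y
    exact ⟨z, rfl⟩

theorem ker_cosyzygyMap (n : ℕ) :
    LinearMap.ker (cosyzygyMap (K := K) (V := V) M n) = (cosyzygies M n).2 := by
  ext x
  refine Iff.trans ?_ (Submodule.Quotient.mk_eq_zero _)
  exact ⟨fun hx ↦ hullMap_injective _ (hx.trans (map_zero _).symm),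
    fun hx ↦ (congrArg (hullMap _) hx).trans (map_zero _)⟩

theorem socle_le_cosyzygies (n : ℕ) : socle K V _ ≤ (cosyzygies (K := K) (V := V) M n).2 := by
  cases n <;> exact socle_le_range_hullMap _

end Hull

/-- The top multiple of a generator lies in the socle, so `topElem b` kills every matrix entry; it
acts on an entry by the constant term, which must vanish. -/
theorem isMinimalMap_of_socle_le_ker {m n : ℕ} {f : (Fin m →₀ ExteriorAlgebra K V)
    →ₗ[ExteriorAlgebra K V] (Fin n →₀ ExteriorAlgebra K V)}
    (hf : socle K V _ ≤ LinearMap.ker f) : IsMinimalMap f := by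
  let b := Module.Free.chooseBasis K V
  have h1 : ∀ i, f (Finsupp.single i 1) ∈ maxIdeal K V •
      (⊤ : Submodule (ExteriorAlgebra K V) (Fin n →₀ ExteriorAlgebra K V)) := by
    intro i
    rw [mem_maxIdeal_smul_top_iff Finsupp.basisSingleOne]
    intro j
    have h2 : topElem b • Finsupp.single i (1 : ExteriorAlgebra K V) ∈ socle K V _ := by
      intro a ha
      rw [smul_smul, show a * topElem b = 0 from ?_, zero_smul]
      obtain ⟨k, z, rfl⟩ := ExteriorAlgebra.exists_eq_sum_of_mem_maxIdeal b ha
      rw [add_mul, Finset.sum_mul, Finset.sum_mul, Finset.sum_eq_zero, zero_add,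
        Finset.sum_eq_zero]
      · intro v _
        rw [Finset.sum_mul]
        refine Finset.sum_eq_zero fun w _ ↦ ?_
        rw [ExteriorAlgebra.ι_mul_eq_involute_mul_ι, mul_assoc, ExteriorAlgebra.ι_mul_topElem,
          mul_zero]
      · intro v _
        rw [smul_mul_assoc, ExteriorAlgebra.ι_mul_topElem, smul_zero]
    have h3 : topElem b • f (Finsupp.single i 1) = 0 := by
      rw [← map_smul]
      exact hf h2
    have h4 := DFunLike.congr_fun h3 j
    rw [Finsupp.smul_apply, smul_eq_mul,
      ExteriorAlgebra.mul_eq_algebraMapInv_smul b (ExteriorAlgebra.topElem_mul_ι b),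
      Finsupp.zero_apply, smul_eq_zero] at h4
    exact (ExteriorAlgebra.mem_maxIdeal_iff _).2
      (h4.resolve_right (ExteriorAlgebra.topElem_ne_zero b))
  rintro _ ⟨x, rfl⟩
  rw [← Finsupp.sum_single x, Finsupp.sum, map_sum]
  refine Submodule.sum_mem _ fun i _ ↦ ?_
  rw [show Finsupp.single i (x i) = x i • Finsupp.single i (1 : ExteriorAlgebra K V) by simp,
    map_smul]
  exact Submodule.smul_mem _ _ (h1 i)

/-- Every finitely generated module has an injective resolution which is a minimal complex of
free modules. -/
theorem exists_minimal_injectiveResolution (M : ModuleCat.{max u v} (ExteriorAlgebra K V))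
    [Module.Finite (ExteriorAlgebra K V) M] :
    ∃ J : InjectiveResolution M, IsMinimalFree J.cocomplex := by
  let A : CochainComplex (ModuleCat.{max u v} (ExteriorAlgebra K V)) ℕ :=
    CochainComplex.of (fun n ↦ ModuleCat.of (ExteriorAlgebra K V)
      (Fin (cosyzygies (K := K) (V := V) M n).1 →₀ ExteriorAlgebra K V))
      (fun n ↦ ModuleCat.ofHom (cosyzygyMap M n)) (fun n ↦ by
        refine ModuleCat.hom_ext (LinearMap.range_le_ker_iff.1 ?_)
        change LinearMap.range (cosyzygyMap M n) ≤ LinearMap.ker (cosyzygyMap M (n + 1))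
        rw [range_cosyzygyMap, ker_cosyzygyMap])
  have hA : ∀ n, A.d n (n + 1) = ModuleCat.ofHom (cosyzygyMap M n) := fun n ↦
    CochainComplex.of_d (fun n ↦ ModuleCat.of (ExteriorAlgebra K V)
      (Fin (cosyzygies (K := K) (V := V) M n).1 →₀ ExteriorAlgebra K V))
      (fun n ↦ ModuleCat.ofHom (cosyzygyMap M n)) n
  let i : M ⟶ A.X 0 := ModuleCat.ofHom (hullMap (K := K) (V := V) M)
  have w : i ≫ A.d 0 1 = 0 := by
    rw [hA]
    refine ModuleCat.hom_ext (LinearMap.range_le_ker_iff.1 ?_)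
    change LinearMap.range (hullMap M) ≤ LinearMap.ker (cosyzygyMap M 0)
    rw [ker_cosyzygyMap]
    exact le_rfl
  refine ⟨injectiveResolutionOfExact A (fun n ↦ ?_) i w ?_ ?_ (fun n ↦ ?_), ⟨fun n ↦ ?_,
    fun i j ↦ ?_⟩⟩
  · exact Module.injective_object_of_injective_module (ExteriorAlgebra K V)
      (Fin (cosyzygies (K := K) (V := V) M n).1 →₀ ExteriorAlgebra K V)
  · exact (ModuleCat.mono_iff_injective i).2 (hullMap_injective _)
  · rw [ShortComplex.moduleCat_exact_iff_range_eq_ker]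
    change LinearMap.range (hullMap M) = LinearMap.ker (A.d 0 1).hom
    rw [hA, ModuleCat.hom_ofHom, ker_cosyzygyMap]
    rfl
  · rw [CochainComplex.exactAt_succ_iff, hA, hA, LinearMap.exact_iff, ModuleCat.hom_ofHom,
      ModuleCat.hom_ofHom, range_cosyzygyMap, ker_cosyzygyMap]
  · exact inferInstanceAs (Module.Free (ExteriorAlgebra K V) (Fin _ →₀ ExteriorAlgebra K V))
  · change IsMinimalMap (A.d i j).hom
    by_cases hij : i + 1 = j
    · subst hij
      rw [hA, ModuleCat.hom_ofHom]
      refine isMinimalMap_of_socle_le_ker ?_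
      rw [ker_cosyzygyMap]
      exact socle_le_cosyzygies M i
    · rw [A.shape i j hij, IsMinimalMap, ModuleCat.hom_zero, LinearMap.range_zero]
      exact bot_le

end MinimalResolutions

/-! ### Frobenius duality and the linear part of an exact chain. -/

section Duality

open CliffordAlgebra (reverse)

variable {K : Type u} [Field K]

theorem LinearMap.exact_dualMap_iff {A B C : Type*} [AddCommGroup A] [Module K A]
    [AddCommGroup B] [Module K B] [AddCommGroup C] [Module K C] (f : A →ₗ[K] B) (g : B →ₗ[K] C) :
    Function.Exact g.dualMap f.dualMap ↔ Function.Exact f g := by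
  rw [LinearMap.exact_iff, LinearMap.exact_iff, LinearMap.ker_dualMap_eq_dualAnnihilator_range,
    LinearMap.range_dualMap_eq_dualAnnihilator_ker, Subspace.dualAnnihilator_inj, eq_comm]

variable {V : Type v} [AddCommGroup V] [Module K V]

theorem isMinimalMap_iff {M N ι κ : Type*} [AddCommGroup M] [Module (ExteriorAlgebra K V) M]
    [AddCommGroup N] [Module (ExteriorAlgebra K V) N]
    (b : Module.Basis ι (ExteriorAlgebra K V) M) (c : Module.Basis κ (ExteriorAlgebra K V) N)
    {f : M →ₗ[ExteriorAlgebra K V] N} :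
    IsMinimalMap f ↔ ∀ i k, c.repr (f (b i)) k ∈ maxIdeal K V := by
  refine ⟨fun h i k ↦ repr_mem_maxIdeal c (h ⟨b i, rfl⟩) k, fun h ↦ ?_⟩
  rintro _ ⟨x, rfl⟩
  rw [← b.linearCombination_repr x, Finsupp.linearCombination_apply, map_finsuppSum]
  refine Submodule.sum_mem _ fun i _ ↦ ?_
  dsimp only
  rw [map_smul]
  exact Submodule.smul_mem _ _ ((mem_maxIdeal_smul_top_iff c).2 (h i))

theorem linMap_basisSingleOne_single {ι κ : Type*}
    (f : (ι →₀ ExteriorAlgebra K V) →ₗ[ExteriorAlgebra K V] (κ →₀ ExteriorAlgebra K V))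
    (i : ι) (k : κ) :
    linMap Finsupp.basisSingleOne Finsupp.basisSingleOne f (Finsupp.single i 1) k =
      linElem (f (Finsupp.single i 1) k) := by
  have h := (Finsupp.basisSingleOne (R := ExteriorAlgebra K V)).constr_basis ℕ (fun i : ι ↦
    Finsupp.basisSingleOne.repr.symm ((Finsupp.basisSingleOne.repr
      (f (Finsupp.basisSingleOne i))).mapRange linElem (map_zero linElem))) i
  rw [Finsupp.coe_basisSingleOne] at h
  exact DFunLike.congr_fun h k

theorem linMap_eq_conj {M N ι κ : Type*} [AddCommGroup M] [Module (ExteriorAlgebra K V) M]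
    [AddCommGroup N] [Module (ExteriorAlgebra K V) N]
    (b : Module.Basis ι (ExteriorAlgebra K V) M) (c : Module.Basis κ (ExteriorAlgebra K V) N)
    (f : M →ₗ[ExteriorAlgebra K V] N) :
    linMap Finsupp.basisSingleOne Finsupp.basisSingleOne
        (c.repr.toLinearMap ∘ₗ f ∘ₗ b.repr.symm.toLinearMap) ∘ₗ b.repr.toLinearMap =
      c.repr.toLinearMap ∘ₗ linMap b c f := by
  refine b.ext fun i ↦ ?_
  ext k
  simp only [LinearMap.comp_apply, LinearEquiv.coe_coe, b.repr_self, linMap_basisSingleOne_single,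
    Module.Basis.repr_symm_single_one]
  rw [linMap, b.constr_basis, LinearEquiv.apply_symm_apply, Finsupp.mapRange_apply]

variable {ι κ μ : Type*} [Finite ι]

/-- The map of free left modules whose matrix is the transpose of that of `f`, with the reversion
applied to all entries. -/
noncomputable def reverseTranspose
    (f : (ι →₀ ExteriorAlgebra K V) →ₗ[ExteriorAlgebra K V] (κ →₀ ExteriorAlgebra K V)) :
    (κ →₀ ExteriorAlgebra K V) →ₗ[ExteriorAlgebra K V] (ι →₀ ExteriorAlgebra K V) :=
  Finsupp.basisSingleOne.constr ℕ fun k ↦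
    Finsupp.equivFunOnFinite.symm fun i ↦ reverse (f (Finsupp.single i 1) k)

theorem reverseTranspose_single
    (f : (ι →₀ ExteriorAlgebra K V) →ₗ[ExteriorAlgebra K V] (κ →₀ ExteriorAlgebra K V))
    (k : κ) (i : ι) :
    reverseTranspose f (Finsupp.single k 1) i = reverse (f (Finsupp.single i 1) k) := by
  have h := (Finsupp.basisSingleOne (R := ExteriorAlgebra K V)).constr_basis ℕ (fun k : κ ↦
    (Finsupp.equivFunOnFinite.symm fun i ↦ reverse (f (Finsupp.single i 1) k) :
      ι →₀ ExteriorAlgebra K V)) k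
  rw [Finsupp.coe_basisSingleOne] at h
  exact DFunLike.congr_fun h i

theorem map_apply_eq_sum {ι κ : Type*} [Fintype ι]
    (f : (ι →₀ ExteriorAlgebra K V) →ₗ[ExteriorAlgebra K V] (κ →₀ ExteriorAlgebra K V))
    (x : ι →₀ ExteriorAlgebra K V) (k : κ) :
    f x k = ∑ i, x i * f (Finsupp.single i 1) k := by
  conv_lhs => rw [← Finsupp.univ_sum_single x]
  rw [map_sum, Finsupp.finsetSum_apply]
  refine Finset.sum_congr rfl fun i _ ↦ ?_
  rw [← smul_eq_mul, ← Finsupp.smul_apply, ← map_smul, Finsupp.smul_single, smul_eq_mul, mul_one]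

/-- The pairing of a free module of finite rank with itself given by a functional. -/
noncomputable def reversePairing {ι : Type*} [Fintype ι]
    (l : Module.Dual K (ExteriorAlgebra K V)) :
    (ι →₀ ExteriorAlgebra K V) →ₗ[K] Module.Dual K (ι →₀ ExteriorAlgebra K V) :=
  LinearMap.mk₂ K (fun w x ↦ l (∑ i, x i * reverse (w i)))
    (by intros; simp [mul_add, Finset.sum_add_distrib])
    (by intros; simp [Finset.mul_sum])
    (by intros; simp [add_mul, Finset.sum_add_distrib])
    (by intros; simp [Finset.mul_sum])

/-- Under the pairing, `reverseTranspose f` becomes the `K`-dual of `f`. -/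
theorem reversePairing_reverseTranspose {ι κ : Type*} [Fintype ι] [Fintype κ]
    (l : Module.Dual K (ExteriorAlgebra K V))
    (f : (ι →₀ ExteriorAlgebra K V) →ₗ[ExteriorAlgebra K V] (κ →₀ ExteriorAlgebra K V))
    (w : κ →₀ ExteriorAlgebra K V) (x : ι →₀ ExteriorAlgebra K V) :
    reversePairing l (reverseTranspose f w) x = reversePairing l w (f x) := by
  change l (∑ i, x i * reverse (reverseTranspose f w i)) = l (∑ k, f x k * reverse (w k))
  congr 1
  simp_rw [map_apply_eq_sum f x, map_apply_eq_sum (reverseTranspose f) w, reverseTranspose_single,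
    map_sum, CliffordAlgebra.reverse.map_mul, CliffordAlgebra.reverse_reverse, Finset.mul_sum,
    Finset.sum_mul, mul_assoc]
  exact Finset.sum_comm

theorem reversePairing_injective {ι : Type*} [Fintype ι]
    {l : Module.Dual K (ExteriorAlgebra K V)} (hl : ∀ x, (∀ a, l (a * x) = 0) → x = 0) :
    Function.Injective (reversePairing (ι := ι) l) := by
  classical
  rw [← LinearMap.ker_eq_bot, LinearMap.ker_eq_bot']
  intro w hw
  ext i
  rw [Finsupp.zero_apply, ← CliffordAlgebra.reverse_reverse (w i), hl (reverse (w i)) ?_, map_zero]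
  intro a
  have h : l (∑ j, (Finsupp.single i a) j * reverse (w j)) = 0 :=
    LinearMap.congr_fun hw (Finsupp.single i a)
  rwa [Finset.sum_eq_single i, Finsupp.single_eq_same] at h
  · intro j _ hj
    rw [Finsupp.single_eq_of_ne hj, zero_mul]
  · exact fun h ↦ absurd (Finset.mem_univ i) h

variable [FiniteDimensional K V]

theorem exists_linearEquiv_reversePairing (ν : Type*) [Fintype ν]
    {l : Module.Dual K (ExteriorAlgebra K V)} (hl : ∀ x, (∀ a, l (a * x) = 0) → x = 0) :
    ∃ e : (ν →₀ ExteriorAlgebra K V) ≃ₗ[K] Module.Dual K (ν →₀ ExteriorAlgebra K V),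
      ∀ w, e w = reversePairing l w :=
  ⟨LinearEquiv.ofInjectiveOfFinrankEq _ (reversePairing_injective hl)
    Subspace.dual_finrank_eq.symm, fun _ ↦ rfl⟩

/-- For a Frobenius functional the pairing is perfect in finite rank, so the claim is that duality
over a field preserves and reflects exactness. -/
theorem exact_reverseTranspose_iff [Finite κ] [Finite μ]
    (f : (ι →₀ ExteriorAlgebra K V) →ₗ[ExteriorAlgebra K V] (κ →₀ ExteriorAlgebra K V))
    (g : (κ →₀ ExteriorAlgebra K V) →ₗ[ExteriorAlgebra K V] (μ →₀ ExteriorAlgebra K V)) :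
    Function.Exact (reverseTranspose g) (reverseTranspose f) ↔ Function.Exact f g := by
  cases nonempty_fintype ι
  cases nonempty_fintype κ
  cases nonempty_fintype μ
  obtain ⟨l, hl⟩ := ExteriorAlgebra.exists_functional K V
  obtain ⟨e₁, h₁⟩ := exists_linearEquiv_reversePairing ι hl
  obtain ⟨e₂, h₂⟩ := exists_linearEquiv_reversePairing κ hl
  obtain ⟨e₃, h₃⟩ := exists_linearEquiv_reversePairing μ hl
  refine Iff.trans ?_ (LinearMap.exact_dualMap_iff (f.restrictScalars K) (g.restrictScalars K))
  refine (Function.Exact.iff_of_ladder_linearEquiv (e₁ := e₃) (e₂ := e₂) (e₃ := e₁)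
    (f₁₂ := (reverseTranspose g).restrictScalars K)
    (f₂₃ := (reverseTranspose f).restrictScalars K) ?_ ?_).symm
  · refine LinearMap.ext fun w ↦ LinearMap.ext fun x ↦ ?_
    exact ((DFunLike.congr_fun (h₃ w) _).trans
      (reversePairing_reverseTranspose l g w x).symm).trans (DFunLike.congr_fun (h₂ _) x).symm
  · refine LinearMap.ext fun w ↦ LinearMap.ext fun x ↦ ?_
    exact ((DFunLike.congr_fun (h₂ w) _).trans
      (reversePairing_reverseTranspose l f w x).symm).trans (DFunLike.congr_fun (h₁ _) x).symm

theorem isMinimalMap_reverseTranspose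
    {f : (ι →₀ ExteriorAlgebra K V) →ₗ[ExteriorAlgebra K V] (κ →₀ ExteriorAlgebra K V)}
    (hf : IsMinimalMap f) : IsMinimalMap (reverseTranspose f) := by
  rw [isMinimalMap_iff Finsupp.basisSingleOne Finsupp.basisSingleOne] at hf ⊢
  intro k i
  rw [Finsupp.coe_basisSingleOne]
  change reverseTranspose f (Finsupp.single k 1) i ∈ _
  rw [reverseTranspose_single]
  have h := hf i k
  rw [Finsupp.coe_basisSingleOne] at h
  exact (ExteriorAlgebra.reverse_mem_maxIdeal h).1

theorem linMap_reverseTranspose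
    {f : (ι →₀ ExteriorAlgebra K V) →ₗ[ExteriorAlgebra K V] (κ →₀ ExteriorAlgebra K V)}
    (hf : IsMinimalMap f) :
    linMap Finsupp.basisSingleOne Finsupp.basisSingleOne (reverseTranspose f) =
      reverseTranspose (linMap Finsupp.basisSingleOne Finsupp.basisSingleOne f) := by
  refine Finsupp.basisSingleOne.ext fun k ↦ Finsupp.ext fun i ↦ ?_
  rw [Finsupp.coe_basisSingleOne, linMap_basisSingleOne_single, reverseTranspose_single,
    reverseTranspose_single, linMap_basisSingleOne_single]
  rw [isMinimalMap_iff Finsupp.basisSingleOne Finsupp.basisSingleOne] at hf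
  have h := hf i k
  rw [Finsupp.coe_basisSingleOne] at h
  exact (ExteriorAlgebra.reverse_mem_maxIdeal h).2

/-- The linear part of an exact sequence `⋯ → X 2 → X 1 → X 0` of minimal maps of free modules of
finite rank is eventually exact. -/
theorem exists_linMap_exact_of_chain {X : ℕ → Type*} [∀ n, AddCommGroup (X n)]
    [∀ n, Module (ExteriorAlgebra K V) (X n)] {ι : ℕ → Type*} [∀ n, Finite (ι n)]
    (b : ∀ n, Module.Basis (ι n) (ExteriorAlgebra K V) (X n))
    (d : ∀ n, X (n + 1) →ₗ[ExteriorAlgebra K V] X n) (hmin : ∀ n, IsMinimalMap (d n))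
    (hex : ∀ n, Function.Exact (d (n + 1)) (d n)) :
    ∃ N, ∀ n ≥ N, Function.Exact (linMap (b (n + 2)) (b (n + 1)) (d (n + 1)))
      (linMap (b (n + 1)) (b n) (d n)) := by
  let D : ∀ n, (ι (n + 1) →₀ ExteriorAlgebra K V) →ₗ[ExteriorAlgebra K V]
      (ι n →₀ ExteriorAlgebra K V) := fun n ↦
    (b n).repr.toLinearMap ∘ₗ d n ∘ₗ (b (n + 1)).repr.symm.toLinearMap
  have hD : ∀ n, IsMinimalMap (D n) := fun n ↦ by
    rw [isMinimalMap_iff Finsupp.basisSingleOne Finsupp.basisSingleOne]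
    intro i k
    rw [Finsupp.coe_basisSingleOne]
    change (b n).repr (d n ((b (n + 1)).repr.symm (Finsupp.single i 1))) k ∈ _
    rw [Module.Basis.repr_symm_single_one]
    exact (isMinimalMap_iff (b (n + 1)) (b n)).1 (hmin n) i k
  have hDex : ∀ n, Function.Exact (D (n + 1)) (D n) := fun n ↦
    (Function.Exact.iff_of_ladder_linearEquiv (e₁ := (b (n + 2)).repr)
      (e₂ := (b (n + 1)).repr) (e₃ := (b n).repr)
      (by ext1 x; simp [D]) (by ext1 x; simp [D])).2 (hex n)
  have hTex : ∀ n, Function.Exact (reverseTranspose (D n)) (reverseTranspose (D (n + 1))) :=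
    fun n ↦ (exact_reverseTranspose_iff _ _).2 (hDex n)
  -- The transposed maps form a cochain complex exact in positive degrees; finite rank makes its
  -- degree-zero cycles finitely generated.
  obtain ⟨N, hN⟩ := exists_linMap_exact
    (fun n ↦ (Finsupp.basisSingleOne : Module.Basis (ι n) (ExteriorAlgebra K V) _))
    (fun n ↦ reverseTranspose (D n)) (fun n ↦ isMinimalMap_reverseTranspose (hD n))
    (fun n x ↦ (hTex n _).2 ⟨x, rfl⟩) (fun n x hx ↦ (hTex n x).1 hx)
    (IsNoetherian.noetherian _)
  refine ⟨N, fun n hn ↦ ?_⟩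
  have h := hN n hn
  rw [linMap_reverseTranspose (hD n), linMap_reverseTranspose (hD (n + 1)),
    exact_reverseTranspose_iff] at h
  exact (Function.Exact.iff_of_ladder_linearEquiv (e₁ := (b (n + 2)).repr)
    (e₂ := (b (n + 1)).repr) (e₃ := (b n).repr) (linMap_eq_conj _ _ _) (linMap_eq_conj _ _ _)).1 h

end Duality

/-! ### Finiteness under homotopy equivalence. -/

section HomotopyInvariance

variable {K : Type u} [Field K] {V : Type v} [AddCommGroup V] [Module K V]

/-- A term of a minimal free complex has finite rank if the corresponding term of a homotopy
equivalent complex is finitely generated. -/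
theorem IsMinimalFree.finite_of_homotopyEquiv [FiniteDimensional K V] {I : Type*}
    {s : ComplexShape I}
    {P G : HomologicalComplex (ModuleCat.{max u v} (ExteriorAlgebra K V)) s}
    (h : HomotopyEquiv P G) (hG : IsMinimalFree G) (n : I)
    [Module.Finite (ExteriorAlgebra K V) (P.X n)] {ι : Type*}
    (b : Module.Basis ι (ExteriorAlgebra K V) (G.X n)) : Finite ι := by
  classical
  obtain ⟨S, hS⟩ := Module.Finite.fg_top (R := ExteriorAlgebra K V) (M := P.X n)
  -- The coordinates that occur in the image of the finitely generated `P.X n`.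
  let T : Finset ι := S.biUnion fun y ↦ (b.repr ((h.hom.f n).hom y)).support
  have hT : ∀ y i, i ∉ T → b.repr ((h.hom.f n).hom y) i = 0 := by
    intro y i hi
    have hy : y ∈ Submodule.span (ExteriorAlgebra K V) (S : Set (P.X n)) := hS ▸ trivial
    refine Submodule.span_induction (fun z hz ↦ ?_) ?_ (fun z z' _ _ hz hz' ↦ ?_)
      (fun a z _ hz ↦ ?_) hy
    · by_contra h'
      exact hi (Finset.mem_biUnion.2 ⟨z, hz, Finsupp.mem_support_iff.2 h'⟩)
    · rw [map_zero, map_zero, Finsupp.zero_apply]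
    · rw [map_add, map_add, Finsupp.add_apply, hz, hz', add_zero]
    · rw [map_smul, map_smul, Finsupp.smul_apply, hz, smul_zero]
  refine Finite.of_surjective (fun i : T ↦ (i : ι)) fun i ↦ ⟨⟨i, ?_⟩, rfl⟩
  -- At a coordinate `i` outside `T` the homotopy identity reads `0 = m + 1` with `m` in the maximal
  -- ideal, since minimality puts both homotopy terms into the maximal ideal times `G.X n`.
  by_contra hi
  have h1 := ConcreteCategory.congr_hom (h.homotopyInvHomId.comm n) (b i)
  have h2 : (h.hom.f n).hom ((h.inv.f n).hom (b i)) =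
      (h.homotopyInvHomId.hom (s.next n) n).hom ((G.d n (s.next n)).hom (b i)) +
        (G.d (s.prev n) n).hom ((h.homotopyInvHomId.hom n (s.prev n)).hom (b i)) + b i := h1
  have h3 : (h.homotopyInvHomId.hom (s.next n) n).hom ((G.d n (s.next n)).hom (b i)) ∈
      maxIdeal K V • (⊤ : Submodule (ExteriorAlgebra K V) (G.X n)) := by
    have h4 := Submodule.mem_map_of_mem (f := (h.homotopyInvHomId.hom (s.next n) n).hom)
      (hG.minimal n (s.next n) ⟨b i, rfl⟩)
    rw [Submodule.map_smul''] at h4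
    exact Submodule.smul_mono le_rfl le_top h4
  have h5 := hG.minimal (s.prev n) n ⟨(h.homotopyInvHomId.hom n (s.prev n)).hom (b i), rfl⟩
  have h6 := add_mem (repr_mem_maxIdeal b h3 i) (repr_mem_maxIdeal b h5 i)
  have h7 := DFunLike.congr_fun (congrArg b.repr h2) i
  rw [hT _ i hi, map_add, map_add, Finsupp.add_apply, Finsupp.add_apply, b.repr_self,
    Finsupp.single_eq_same] at h7
  rw [eq_neg_of_add_eq_zero_left h7.symm, neg_mem_iff, ExteriorAlgebra.mem_maxIdeal_iff,
    map_one] at h6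
  exact one_ne_zero h6

/-- `G.X 0` may have infinite rank, so noetherianity does not apply directly. In degree zero nothing
comes in, so on cycles the homotopy term vanishes and the kernel is the image of `M`. -/
theorem CategoryTheory.InjectiveResolution.fg_ker_of_homotopyEquiv {R : Type u} [Ring R]
    {M : ModuleCat.{v} R} [Module.Finite R M]
    (F : InjectiveResolution M) {G : CochainComplex (ModuleCat.{v} R) ℕ}
    (h : HomotopyEquiv F.cocomplex G) : (LinearMap.ker (G.d 0 1).hom).FG := by
  let φ : M →ₗ[R] G.X 0 := (h.hom.f 0).hom ∘ₗ (F.ι.f 0).hom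
  suffices hφ : LinearMap.ker (G.d 0 1).hom = LinearMap.range φ by
    rw [hφ, LinearMap.range_eq_map]
    exact Module.Finite.fg_top.map φ
  apply le_antisymm
  · intro z hz
    have h1 := ConcreteCategory.congr_hom (h.homotopyInvHomId.comm 0) z
    rw [Homotopy.dNext_cochainComplex, Homotopy.prevD_zero_cochainComplex, add_zero] at h1
    have h2 : (h.hom.f 0).hom ((h.inv.f 0).hom z) =
      (h.homotopyInvHomId.hom 1 0).hom ((G.d 0 1).hom z) + z := h1
    rw [LinearMap.mem_ker.1 hz, map_zero, zero_add] at h2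
    have h3 : (F.cocomplex.d 0 1).hom ((h.inv.f 0).hom z) = 0 := by
      have h4 := ConcreteCategory.congr_hom (h.inv.comm 0 1) z
      refine Eq.trans h4 ?_
      change (h.inv.f 1).hom ((G.d 0 1).hom z) = 0
      rw [LinearMap.mem_ker.1 hz, map_zero]
    have h5 := (ShortComplex.moduleCat_exact_iff _).1 F.exact₀ _ h3
    obtain ⟨y, hy⟩ := h5
    refine ⟨y, ?_⟩
    exact (congrArg (h.hom.f 0).hom hy).trans h2
  · rintro _ ⟨y, rfl⟩
    have h4 := ConcreteCategory.congr_hom (h.hom.comm 0 1) ((F.ι.f 0).hom y)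
    refine LinearMap.mem_ker.2 (Eq.trans h4 ?_)
    have h5 := ConcreteCategory.congr_hom F.ι_f_zero_comp_complex_d y
    exact (congrArg (h.hom.f 1).hom h5).trans (map_zero _)

end HomotopyInvariance

/-! ### Eventual exactness for both kinds of resolution. -/

section EventuallyExact

variable {K : Type u} [Field K] {V : Type v} [AddCommGroup V] [Module K V]

/-- A complex homotopy equivalent to a minimal free complex has a linear part. -/
theorem IsMinimalFree.exists_isLinearPart {I : Type*} {s : ComplexShape I}
    {F G : HomologicalComplex (ModuleCat.{max u v} (ExteriorAlgebra K V)) s}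
    (hG : IsMinimalFree G) (h : HomotopyEquiv F G) : ∃ L, IsLinearPart F L := by
  have := hG.free
  exact ⟨_, G, hG, _, fun i ↦ Module.Free.chooseBasis (ExteriorAlgebra K V) (G.X i), ⟨h⟩,
    ⟨Iso.refl _⟩⟩

variable [FiniteDimensional K V] {M : ModuleCat.{max u v} (ExteriorAlgebra K V)}
  [Module.Finite (ExteriorAlgebra K V) M]

theorem CategoryTheory.ProjectiveResolution.exists_exactAt_of_isLinearPart
    (F : ProjectiveResolution M)
    {L : ChainComplex (ModuleCat.{max u v} (ExteriorAlgebra K V)) ℕ}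
    (hL : IsLinearPart F.complex L) : ∃ N : ℕ, ∀ n ≥ N, L.ExactAt n := by
  obtain ⟨G, hG, ι, b, ⟨h⟩, ⟨e⟩⟩ := hL
  obtain ⟨P, -, hPfin⟩ := exists_minimal_projectiveResolution M
  -- `F` may have infinite rank; the resolution `P` with finitely generated terms is homotopy
  -- equivalent to it and forces finite rank on `G`.
  have := fun n ↦ hG.finite_of_homotopyEquiv ((P.homotopyEquiv F).trans h) n (b n)
  have hex : ∀ n, G.ExactAt (n + 1) := fun n ↦
    (exactAt_iff_of_quasiIsoAt h.hom (n + 1)).1 (F.complex_exactAt_succ n)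
  obtain ⟨N, hN⟩ := exists_linMap_exact_of_chain b (fun n ↦ (G.d (n + 1) n).hom)
    (fun n ↦ hG.minimal _ _) (fun n ↦ (ChainComplex.exactAt_succ_iff G n).1 (hex n))
  refine ⟨N + 1, fun n hn ↦ ?_⟩
  obtain ⟨m, rfl⟩ := Nat.exists_eq_add_of_le' (le_of_add_le_right hn)
  refine HomologicalComplex.ExactAt.of_iso ?_ e.symm
  exact (ChainComplex.exactAt_succ_iff (linComplex G hG b) m).2 (hN m (by lia))

theorem CategoryTheory.InjectiveResolution.exists_exactAt_of_isLinearPart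
    (F : InjectiveResolution M)
    {L : CochainComplex (ModuleCat.{max u v} (ExteriorAlgebra K V)) ℕ}
    (hL : IsLinearPart F.cocomplex L) : ∃ N : ℕ, ∀ n ≥ N, L.ExactAt n := by
  obtain ⟨G, hG, ι, b, ⟨h⟩, ⟨e⟩⟩ := hL
  have hex : ∀ n, Function.Exact (G.d n (n + 1)).hom (G.d (n + 1) (n + 2)).hom := fun n ↦
    (CochainComplex.exactAt_succ_iff G n).1
      ((exactAt_iff_of_quasiIsoAt h.hom (n + 1)).1 (F.cocomplex_exactAt_succ n))
  obtain ⟨N, hN⟩ := exists_linMap_exact b (fun n ↦ (G.d n (n + 1)).hom)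
    (fun n ↦ hG.minimal _ _) (fun n x ↦ (hex n _).2 ⟨x, rfl⟩) (fun n x hx ↦ (hex n x).1 hx)
    (F.fg_ker_of_homotopyEquiv h)
  refine ⟨N + 1, fun n hn ↦ ?_⟩
  obtain ⟨m, rfl⟩ := Nat.exists_eq_add_of_le' (le_of_add_le_right hn)
  refine HomologicalComplex.ExactAt.of_iso ?_ e.symm
  exact (CochainComplex.exactAt_succ_iff (linComplex G hG b) m).2 (hN m (by lia))

end EventuallyExact

theorem theorem3p1 (K : Type u) [Field K] (V : Type v) [AddCommGroup V] [Module K V]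
    [FiniteDimensional K V] (M : ModuleCat.{max u v} (ExteriorAlgebra K V))
    [Module.Finite (ExteriorAlgebra K V) M] :
    (∀ F : ProjectiveResolution M,
      (∀ i, Module.Free (ExteriorAlgebra K V) (F.complex.X i)) →
        (∃ L : ChainComplex (ModuleCat.{max u v} (ExteriorAlgebra K V)) ℕ,
          IsLinearPart F.complex L) ∧
        ∀ L : ChainComplex (ModuleCat.{max u v} (ExteriorAlgebra K V)) ℕ,
          IsLinearPart F.complex L → ∃ N : ℕ, ∀ n ≥ N, L.ExactAt n) ∧
    (∀ F : InjectiveResolution M,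
        (∃ L : CochainComplex (ModuleCat.{max u v} (ExteriorAlgebra K V)) ℕ,
          IsLinearPart F.cocomplex L) ∧
        ∀ L : CochainComplex (ModuleCat.{max u v} (ExteriorAlgebra K V)) ℕ,
          IsLinearPart F.cocomplex L → ∃ N : ℕ, ∀ n ≥ N, L.ExactAt n) := by
  refine ⟨fun F _ ↦ ⟨?_, fun L hL ↦ F.exists_exactAt_of_isLinearPart hL⟩,
    fun F ↦ ⟨?_, fun L hL ↦ F.exists_exactAt_of_isLinearPart hL⟩⟩
  · obtain ⟨P, hP, -⟩ := exists_minimal_projectiveResolution M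
    exact hP.exists_isLinearPart (F.homotopyEquiv P)
  · obtain ⟨J, hJ⟩ := exists_minimal_injectiveResolution M
    exact hJ.exists_isLinearPart (F.homotopyEquiv J)
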